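/- Let $T\in[0,\infty)$, $x_0\in\mathbb R^d$, $l_1,\dots,l_k\in\mathbb Z^d$, let $Y_1,\dots,Y_k$ be independent rate-$1$ Poisson processes on a probability space, and let $f_1,\dots,f_k:[0,T]\times\mathbb R^d\to\mathbb R$ be continuous. Let $X$ be a solution on $[0,T]$ of $$X(t)=x_0+\sum_{i=1}^k l_i\,Y_i\Big(\int_0^t f_i(s,X(s))\,ds\Big).$$ Put $\mu(t)=E[X(t)]$ and, for $t\in[0,T]$ and $m\in\mathbb R^d$, $$g_i(t,m)=E\big[f_i\big(t,\,X(t)-\mu(t)+m\big)\big],$$ so that $g_i(t,\mu(t))=E[f_i(t,X(t))]$. For each integer $n\ge 1$ let $Z_n$ be a solution on $[0,T]$ of $$Z_n(t)=x_0+\sum_{i=1}^k \frac1n\, l_i\,Y_i\Big(\int_0^t n\,g_i(s,Z_n(s))\,ds\Big).$$ Here a solution is a stochastic process satisfying the equation almost surely for all $t\in[0,T]$; this includes that the rates ($f_i(s,X(s))$, respectively $g_i(s,Z_n(s))$) are nonnegative and integrable over $s\in[0,T]$ along almost every path, so that the arguments of the $Y_i$ are nondecreasing and lie in $[0,\infty)$.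 Assume that there are constants $C_1,\dots,C_k,M<\infty$ such that, for all $t\in[0,T]$ and $x,y\in\mathbb R^d$, $$|f_i(t,x)|\le C_i(1+|x|)\quad(i=1,\dots,k),\qquad |F(t,x)-F(t,y)|\le M|x-y|,\quad\text{where } F(t,x)=\sum_{i=1}^k l_i f_i(t,x).$$ Then all the expectations above exist and are finite, the integral equation $$\bar Z(t)=x_0+\sum_{i=1}^k l_i\int_0^t g_i(s,\bar Z(s))\,ds,\qquad t\in[0,T],$$ has exactly one solution $\bar Z$ on $[0,T]$, and almost surely $Z_n(t)\to\bar Z(t)$ as $n\to\infty$, uniformly in $t\in[0,T]$. Furthermore, for all $t\in[0,T]$, $$\bar Z(t)=E[X(t)]=x_0+\sum_{i=1}^k l_i\int_0^t E\big[f_i(s,X(s))\big]\,ds .$$ -/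

import Mathlib

open MeasureTheory ProbabilityTheory Filter Set
open scoped NNReal Topology

noncomputable section

/-- A rate-one Poisson process `N` on `[0, ∞)`: a counting process started at `0`, with almost
surely nondecreasing right-continuous paths, independent increments, and Poisson increments
of parameter `t - s` over `(s, t]`. -/
structure IsUnitPoissonProcess {Ω : Type*} [MeasurableSpace Ω] (P : Measure Ω)
    (N : ℝ≥0 → Ω → ℕ) : Prop where
  measurable : ∀ t, Measurable (N t)
  zero : ∀ᵐ ω ∂P, N 0 ω = 0
  monotone : ∀ᵐ ω ∂P, Monotone fun t => N t ω
  rightCont : ∀ᵐ ω ∂P, ∀ t, ContinuousWithinAt (fun s => N s ω) (Ici t) t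
  indepIncrements : HasIndepIncrements N P
  map_increment : ∀ s t : ℝ≥0, s ≤ t →
    P.map (fun ω => N t ω - N s ω) = poissonMeasure (t - s)

/-- A family `Y` of mutually independent rate-one Poisson processes. -/
structure IsIndepUnitPoissonFamily {Ω ι : Type*} [MeasurableSpace Ω] (P : Measure Ω)
    (Y : ι → ℝ≥0 → Ω → ℕ) : Prop where
  poisson : ∀ i, IsUnitPoissonProcess P (Y i)
  indep : iIndepFun (fun i ω t => Y i t ω) P

/-- An integer vector, as an element of Euclidean space. -/
def intVec {d : ℕ} (l : Fin d → ℤ) : EuclideanSpace ℝ (Fin d) :=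
  WithLp.toLp 2 fun j => (l j : ℝ)

/-- `X` is, on the time interval `[0, T]`, a solution of
`X(t) = x₀ + ∑ i, Y i (∫₀ᵗ r i (s, X s) ds) • v i`, almost surely for all `t ∈ [0, T]`.
The processes `Y i` live on `[0, ∞)` and the `r i` are jump rates, so the equation includes that
along the path the rates are nonnegative and integrable over `[0, T]`. -/
structure IsTimeChangeSolution {Ω : Type*} [MeasurableSpace Ω] (P : Measure Ω) {d k : ℕ}
    (T : ℝ) (x₀ : EuclideanSpace ℝ (Fin d)) (Y : Fin k → ℝ≥0 → Ω → ℕ)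
    (v : Fin k → EuclideanSpace ℝ (Fin d)) (r : Fin k → ℝ → EuclideanSpace ℝ (Fin d) → ℝ)
    (X : ℝ → Ω → EuclideanSpace ℝ (Fin d)) : Prop where
  aemeasurable : ∀ t ∈ Icc 0 T, AEMeasurable (X t) P
  rate_nonneg : ∀ᵐ ω ∂P, ∀ i, ∀ s ∈ Icc 0 T, 0 ≤ r i s (X s ω)
  rate_integrable : ∀ᵐ ω ∂P, ∀ i, IntegrableOn (fun s => r i s (X s ω)) (Icc 0 T)
  equation : ∀ᵐ ω ∂P, ∀ t ∈ Icc 0 T,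
    X t ω = x₀ + ∑ i, (Y i (∫ s in (0 : ℝ)..t, r i s (X s ω)).toNNReal ω : ℝ) • v i

/-- The mean-based rate attached to `f` and the process `X`:
`g t m = E[f t (X₀ t + m)]`, where `X₀ t = X t - E[X t]` has the centred law of `X t`
(its base distribution). -/
def adjustedRate {Ω : Type*} [MeasurableSpace Ω] (P : Measure Ω) {d : ℕ}
    (X : ℝ → Ω → EuclideanSpace ℝ (Fin d)) (f : ℝ → EuclideanSpace ℝ (Fin d) → ℝ)
    (t : ℝ) (m : EuclideanSpace ℝ (Fin d)) : ℝ :=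
  ∫ ω, f t ((X t ω - ∫ ω', X t ω' ∂P) + m) ∂P

/-- The defining property of the mean-based rate: `g t (E[X t]) = E[f t (X t)]`. -/
theorem adjustedRate_mean {Ω : Type*} [MeasurableSpace Ω] (P : Measure Ω) {d : ℕ}
    (X : ℝ → Ω → EuclideanSpace ℝ (Fin d)) (f : ℝ → EuclideanSpace ℝ (Fin d) → ℝ) (t : ℝ) :
    adjustedRate P X f t (∫ ω, X t ω ∂P) = ∫ ω, f t (X t ω) ∂P := by
  simp [adjustedRate]

/-- `z` is, on `[0, T]`, a solution of the deterministic integral equation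
`z(t) = x₀ + ∑ i, (∫₀ᵗ g i (s, z s) ds) • v i`. -/
structure IsFluidSolution {d k : ℕ} (T : ℝ) (x₀ : EuclideanSpace ℝ (Fin d))
    (v : Fin k → EuclideanSpace ℝ (Fin d)) (g : Fin k → ℝ → EuclideanSpace ℝ (Fin d) → ℝ)
    (z : ℝ → EuclideanSpace ℝ (Fin d)) : Prop where
  integrable : ∀ i, IntegrableOn (fun s => g i s (z s)) (Icc 0 T)
  equation : ∀ t ∈ Icc 0 T, z t = x₀ + ∑ i, (∫ s in (0 : ℝ)..t, g i s (z s)) • v i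

end

/-! Everything rests on the mean formula `E[X t] = x₀ + ∑ i, (∫₀ᵗ E[f i s (X s)] ds) • v i`. Since
the adjusted rate at `E[X t]` is `E[f i t (X t)]`, the formula says that the mean of `X` solves the
fluid equation. Averaging over shifts keeps the Lipschitz bound of the summed drift, so Grönwall's
inequality gives uniqueness. By the strong law, `Y i (n u) / n` is uniformly close to `u` on bounded
sets, and a second use of Grönwall gives `Z n → z` path by path (`tendstoUniformlyOn_fluid`).

The mean formula amounts to `E[Y i (τ i)] = E[τ i]` for the random clocks `τ i`. This is optional
stopping (`IsUnitPoissonProcess.lintegral_stopped`): whether `τ i` has reached `a` should be decided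
by the other paths and by `Y i` up to `a`, data independent of the later increments of `Y i`. The
solution is not assumed adapted, so this is extracted from the equation. The state is a function of
the jump counts, and between jumps the rates depend on time alone, so the clocks can be rebuilt as
measurable functionals of the driving paths: `frozenClock` at stage `n` is the solution stopped when
the total count reaches `n` (`IsClockSolution.frozenClock_eq_stoppedClock`), and it has the required
nonanticipation property (`le_frozenClock_stopPath_iff`). Induction on `n` bounds the means
uniformly, and monotone convergence removes the freezing. -/

theorem lintegral_natCast_poissonMeasure (r : ℝ≥0) :
    ∫⁻ n, (n : ENNReal) ∂poissonMeasure r = r := by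
  rw [poissonMeasure, lintegral_sum_measure]
  simp only [lintegral_smul_measure, lintegral_dirac, smul_eq_mul]
  rw [tsum_eq_zero_add' ENNReal.summable]
  have h : ∀ n : ℕ, ENNReal.ofReal (Real.exp (-r) * r ^ (n + 1) / (n + 1).factorial) * ((n + 1 : ℕ) : ENNReal)
      = r * ENNReal.ofReal (Real.exp (-r) * r ^ n / n.factorial) := by
    intro n
    rw [← ENNReal.ofReal_natCast, ← ENNReal.ofReal_coe_nnreal, ← ENNReal.ofReal_mul (by positivity),
      ← ENNReal.ofReal_mul (by positivity), Nat.factorial_succ]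
    congr 1
    push_cast
    have : ((n : ℝ) + 1) ≠ 0 := by positivity
    field_simp
    ring
  simp only [h, Nat.cast_zero, mul_zero, zero_add]
  rw [ENNReal.tsum_mul_left, ← ENNReal.ofReal_tsum_of_nonneg (fun n => by positivity)
    (hasSum_one_poissonMeasure r).summable, (hasSum_one_poissonMeasure r).tsum_eq]
  simp

/-- A finite subset of `[0, a]` is enumerated by a monotone sequence from `0` to `a`. -/
theorem exists_monotone_seq_of_finset (J : Finset ℝ≥0) : ∀ a : ℝ≥0, (∀ s ∈ J, s ≤ a) →
    ∃ (m : ℕ) (t : ℕ → ℝ≥0), Monotone t ∧ t 0 = 0 ∧ (∀ i, m ≤ i → t i = a) ∧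
      ∀ s ∈ J, ∃ i ≤ m, t i = s := by
  induction J using Finset.induction_on_max with
  | empty =>
    intro a _
    refine ⟨1, fun i => if i = 0 then 0 else a, ?_, by simp, ?_, by simp⟩
    · intro i j hij
      dsimp only
      split_ifs with h1 h2 h2
      exacts [le_rfl, zero_le, absurd h2 (by omega), le_rfl]
    · intro i hi
      simp; omega
  | insert x J hx ih =>
    intro a ha
    obtain ⟨m, t, ht, h0, hm, hJ⟩ := ih x fun s hs => (hx s hs).le
    have hxa : x ≤ a := ha x (by simp)
    refine ⟨m + 1, fun i => if i ≤ m then t i else a, ?_, by simp [h0], ?_, ?_⟩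
    · intro i j hij
      dsimp only
      split_ifs with h1 h2 h2
      · exact ht hij
      · exact (ht h1).trans ((hm m le_rfl).trans_le hxa)
      · omega
      · exact le_rfl
    · intro i hi
      simp; omega
    · intro s hs
      rcases Finset.mem_insert.1 hs with rfl | hs
      · exact ⟨m, by omega, by simp [hm]⟩
      · obtain ⟨i, hi, rfl⟩ := hJ s hs
        exact ⟨i, by omega, by simp [hi]⟩

/-! ### Independence of stopped paths and later increments -/

section

variable {Ω : Type*} [MeasurableSpace Ω] {P : Measure Ω}

/-- The path of a Poisson process stopped at time `a` is independent of its later increments. -/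
theorem IsUnitPoissonProcess.indepFun_stopped_increment [IsProbabilityMeasure P]
    {N : ℝ≥0 → Ω → ℕ} (hN : IsUnitPoissonProcess P N) {a b : ℝ≥0} (hab : a ≤ b) :
    IndepFun (fun ω s => N (min s a) ω) (fun ω => N b ω - N a ω) P := by
  refine IndepFun.process_indepFun (fun s => hN.measurable _)
    ((hN.measurable b).sub (hN.measurable a)) fun I => ?_
  obtain ⟨m, t, ht, h0, hm, hJ⟩ := exists_monotone_seq_of_finset (I.image (min · a)) a (by simp)
  -- The grid has `t' m = a` and `t' (m + 1) = b`: its increment number `m` is `N b - N a`, and the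
  -- earlier ones determine the stopped path.
  set t' : ℕ → ℝ≥0 := fun i => if i ≤ m then t i else b
  have ht' : Monotone t' := by
    intro i j hij
    simp only [t']
    split_ifs with h1 h2 h2
    · exact ht hij
    · exact (ht h1).trans ((hm m le_rfl).trans_le hab)
    · omega
    · exact le_rfl
  have hind := hN.indepIncrements.nat ht'
  have hfin := hind.indepFun_finset (Finset.range m) {m} (by simp)
    (fun i => (hN.measurable _).sub (hN.measurable _))
  choose! c hc hcs using hJ
  have hcomp := hfin.comp (_mγ := MeasurableSpace.pi) (_mγ' := inferInstance) (φ := fun (x : Finset.range m → ℕ) (s : I) =>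
      ∑ i ∈ (Finset.range m).attach, if i.1 < c (min s.1 a) then x i else 0)
    (ψ := fun x : ({m} : Finset ℕ) → ℕ => x ⟨m, by simp⟩)
    .of_discrete .of_discrete
  refine hcomp.congr ?_ ?_
  · filter_upwards [hN.zero, hN.monotone] with ω hz hmono
    ext s
    have hsJ : min s.1 a ∈ I.image (min · a) := Finset.mem_image_of_mem _ s.2
    have hle := hc _ hsJ
    simp only [Function.comp]
    rw [Finset.sum_attach (Finset.range m) (fun i => if i < c (min s.1 a) then
      N (t' (i + 1)) ω - N (t' i) ω else 0), ← Finset.sum_filter]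
    have : (Finset.range m).filter (· < c (min s.1 a)) = Finset.range (c (min s.1 a)) := by
      ext i; simp; omega
    rw [this, Finset.sum_range_tsub (f := fun i => N (t' i) ω) (fun i j hij => hmono (ht' hij))]
    simp only [t', hle, if_true, hcs _ hsJ, Nat.zero_le, h0, hz, Nat.sub_zero]
  · refine .of_forall fun ω => ?_
    simp [t', hm]

/-- If `A` is independent of `(B, D)` and `B` is independent of `D`, then `(A, B)` is
independent of `D`. -/
theorem IndepFun.prodMk_left_of_prodMk_right {α β γ : Type*} [MeasurableSpace α]
    [MeasurableSpace β] [MeasurableSpace γ] [IsProbabilityMeasure P] {A : Ω → α} {B : Ω → β}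
    {D : Ω → γ} (hA : Measurable A) (hB : Measurable B) (hD : Measurable D)
    (h : IndepFun A (fun ω => (B ω, D ω)) P) (h' : IndepFun B D P) :
    IndepFun (fun ω => (A ω, B ω)) D P := by
  have hAB : IndepFun A B P := h.comp measurable_id measurable_fst
  have e1 := (indepFun_iff_map_prod_eq_prod_map_map hA.aemeasurable
    (hB.prodMk hD).aemeasurable).1 h
  have e2 := (indepFun_iff_map_prod_eq_prod_map_map hB.aemeasurable hD.aemeasurable).1 h'
  have e3 := (indepFun_iff_map_prod_eq_prod_map_map hA.aemeasurable hB.aemeasurable).1 hAB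
  have := Measure.isProbabilityMeasure_map (μ := P) hA.aemeasurable
  have := Measure.isProbabilityMeasure_map (μ := P) hB.aemeasurable
  have := Measure.isProbabilityMeasure_map (μ := P) hD.aemeasurable
  rw [indepFun_iff_map_prod_eq_prod_map_map (hA.prodMk hB).aemeasurable hD.aemeasurable, e3,
    ← ((measurePreserving_prodAssoc (P.map A) (P.map B) (P.map D)).symm _).map_eq, ← e2, ← e1,
    Measure.map_map MeasurableEquiv.prodAssoc.symm.measurable (hA.prodMk (hB.prodMk hD))]
  rfl

/-- The family `y` with its `i`-th path stopped at time `a`. -/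
def stopPath {ι : Type*} [DecidableEq ι] (i : ι) (a : ℝ≥0) (y : ι → ℝ≥0 → ℕ) : ι → ℝ≥0 → ℕ :=
  fun j s => if j = i then y j (min s a) else y j s

/-- The other paths are independent of the whole `i`-th path, hence of the pair formed by its
stopped part and its later increment. `IndepFun.prodMk_left_of_prodMk_right` regroups the three
pieces. -/
theorem IsIndepUnitPoissonFamily.indepFun_stopPath_increment [IsProbabilityMeasure P]
    {ι : Type*} [Finite ι] [DecidableEq ι] {Y : ι → ℝ≥0 → Ω → ℕ}
    (hY : IsIndepUnitPoissonFamily P Y) (i : ι) {a b : ℝ≥0} (hab : a ≤ b) :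
    IndepFun (fun ω => stopPath i a fun j s => Y j s ω) (fun ω => Y i b ω - Y i a ω) P := by
  have := Fintype.ofFinite ι
  have hm : ∀ j, Measurable fun ω t => Y j t ω := fun j =>
    measurable_pi_lambda _ fun t => (hY.poisson j).measurable t
  have h1 := hY.indep.indepFun_finset (Finset.univ.erase i) {i} (by simp) hm
  have hB : Measurable fun ω (s : ℝ≥0) => Y i (min s a) ω :=
    measurable_pi_lambda _ fun t => (hY.poisson i).measurable _
  have hD : Measurable fun ω => Y i b ω - Y i a ω :=
    ((hY.poisson i).measurable b).sub ((hY.poisson i).measurable a)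
  have h2 : IndepFun (fun ω (j : (Finset.univ.erase i : Finset ι)) t => Y j t ω)
      (fun ω => ((fun s => Y i (min s a) ω), Y i b ω - Y i a ω)) P :=
    h1.comp (φ := id) (ψ := fun x : (({i} : Finset ι) → ℝ≥0 → ℕ) =>
      ((fun s => x ⟨i, by simp⟩ (min s a)), x ⟨i, by simp⟩ b - x ⟨i, by simp⟩ a)) measurable_id
      (by fun_prop)
  have h3 := IndepFun.prodMk_left_of_prodMk_right
    (A := fun ω (j : (Finset.univ.erase i : Finset ι)) t => Y j t ω)
    (measurable_pi_lambda _ fun j => hm j) hB hD h2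
    ((hY.poisson i).indepFun_stopped_increment hab)
  have hφ : Measurable fun (p : (↥(Finset.univ.erase i) → ℝ≥0 → ℕ) × (ℝ≥0 → ℕ))
      (j : ι) (s : ℝ≥0) => if h : j = i then p.2 s else p.1 ⟨j, by simp [h]⟩ s := by
    refine measurable_pi_lambda _ fun j => measurable_pi_lambda _ fun s => ?_
    by_cases h : j = i
    · simp only [h, dite_true]; fun_prop
    · simp only [h, dite_false]; fun_prop
  refine (h3.comp hφ measurable_id).congr (.of_forall fun ω => ?_) .rfl
  ext j s
  by_cases h : j = i
  · subst h; simp [stopPath]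
  · simp [stopPath, h]

end

/-! ### Discretised times and measurable evaluation of paths -/

/-- The first point of `(m + 1)⁻¹ ℕ` to the right of `u`. -/
noncomputable def gridPt (m : ℕ) (u : ℝ≥0) : ℝ≥0 := (⌊u * (m + 1)⌋₊ + 1 : ℕ) / ((m : ℝ≥0) + 1)

theorem lt_gridPt (m : ℕ) (u : ℝ≥0) : u < gridPt m u := by
  rw [gridPt, lt_div_iff₀ (by positivity)]
  exact_mod_cast Nat.lt_floor_add_one (u * ((m : ℝ≥0) + 1))

theorem gridPt_le (m : ℕ) (u : ℝ≥0) : gridPt m u ≤ u + 1 / ((m : ℝ≥0) + 1) := by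
  rw [gridPt, div_le_iff₀ (by positivity), add_mul, one_div, inv_mul_cancel₀ (by positivity)]
  push_cast
  gcongr
  exact Nat.floor_le (by positivity)

/-- Supplies one majorant for all `m` in dominated convergence. -/
theorem gridPt_le_gridPt_zero (m : ℕ) (u : ℝ≥0) : gridPt m u ≤ gridPt 0 u := by
  rw [gridPt, div_le_iff₀ (by positivity)]
  have h : ⌊u * ((m : ℝ≥0) + 1)⌋₊ < (⌊u⌋₊ + 1) * (m + 1) := by
    rw [Nat.floor_lt (by positivity)]
    push_cast
    gcongr
    exact Nat.lt_floor_add_one u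
  have h2 : ((⌊u * ((m : ℝ≥0) + 1)⌋₊ + 1 : ℕ) : ℝ≥0) ≤ ((⌊u⌋₊ + 1) * (m + 1) : ℕ) := by
    exact_mod_cast h
  refine h2.trans (le_of_eq ?_)
  simp [gridPt]

theorem tendsto_gridPt (u : ℝ≥0) : Tendsto (fun m => gridPt m u) atTop (𝓝[≥] u) := by
  refine tendsto_nhdsWithin_iff.2 ⟨?_, .of_forall fun m => (lt_gridPt m u).le⟩
  refine tendsto_of_tendsto_of_tendsto_of_le_of_le tendsto_const_nhds ?_
    (fun m => (lt_gridPt m u).le) (fun m => gridPt_le m u)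
  have : Tendsto (fun m : ℕ => 1 / ((m : ℝ≥0) + 1)) atTop (𝓝 0) := by
    exact_mod_cast tendsto_one_div_add_atTop_nhds_zero_nat (𝕜 := ℝ≥0)
  simpa using this.const_add u

theorem measurable_gridPt (m : ℕ) : Measurable (gridPt m) := by
  unfold gridPt
  have : Measurable fun n : ℕ => ((n + 1 : ℕ) : ℝ≥0) / ((m : ℝ≥0) + 1) := .of_discrete
  exact this.comp (Nat.measurable_floor.comp (by fun_prop))

/-- Right-continuous nondecreasing integer paths started at `0`. -/
structure IsCountingPath (p : ℝ≥0 → ℕ) : Prop where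
  zero : p 0 = 0
  mono : Monotone p
  rightCont : ∀ t, ContinuousWithinAt p (Ici t) t

theorem IsCountingPath.eventually_eq {p : ℝ≥0 → ℕ} (hp : IsCountingPath p) (u : ℝ≥0) :
    ∀ᶠ s in 𝓝[≥] u, p s = p u := by
  have := hp.rightCont u
  rw [ContinuousWithinAt, nhds_discrete, tendsto_pure] at this
  exact this

/-- The value of a right-continuous path, as a jointly measurable function of the path and the
time. -/
noncomputable def pathEval (p : ℝ≥0 → ℕ) (u : ℝ≥0) : ℕ := ⨅ m, p (gridPt m u)

theorem IsCountingPath.pathEval_eq {p : ℝ≥0 → ℕ} (hp : IsCountingPath p) (u : ℝ≥0) :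
    pathEval p u = p u := by
  obtain ⟨m, hm⟩ := ((tendsto_gridPt u).eventually (hp.eventually_eq u)).exists
  exact le_antisymm ((ciInf_le (OrderBot.bddBelow _) m).trans hm.le)
    (le_ciInf fun m => hp.mono (lt_gridPt m u).le)

/-- For fixed `m` the time enters only through a natural number, and evaluation at countably many
fixed times is jointly measurable. -/
theorem measurable_pathEval : Measurable fun x : (ℝ≥0 → ℕ) × ℝ≥0 => pathEval x.1 x.2 := by
  refine Measurable.iInf fun m => ?_
  have h : Measurable fun x : (ℝ≥0 → ℕ) × ℕ => x.1 ((x.2 + 1 : ℕ) / ((m : ℝ≥0) + 1)) :=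
    measurable_from_prod_countable_left fun n =>
      measurable_pi_apply (((n + 1 : ℕ) : ℝ≥0) / ((m : ℝ≥0) + 1))
  exact h.comp (measurable_fst.prodMk (Nat.measurable_floor.comp (by fun_prop)))

theorem IsCountingPath.stopped {p : ℝ≥0 → ℕ} (hp : IsCountingPath p) (a : ℝ≥0) :
    IsCountingPath fun s => p (min s a) where
  zero := by simp [hp.zero]
  mono := fun s t h => hp.mono (min_le_min_right a h)
  rightCont t := by
    refine ContinuousWithinAt.comp (t := Ici (min t a)) (hp.rightCont (min t a)) ?_ ?_
    · exact (continuous_id.min continuous_const).continuousWithinAt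
    · intro s hs
      exact min_le_min_right a hs

/-! ### Optional stopping for one Poisson process -/

section

variable {Ω : Type*} [MeasurableSpace Ω] {P : Measure Ω}

theorem IsUnitPoissonProcess.ae_isCountingPath {N : ℝ≥0 → Ω → ℕ}
    (hN : IsUnitPoissonProcess P N) : ∀ᵐ ω ∂P, IsCountingPath fun t => N t ω := by
  filter_upwards [hN.zero, hN.monotone, hN.rightCont] with ω h1 h2 h3 using ⟨h1, h2, h3⟩

theorem IsUnitPoissonProcess.lintegral_increment {N : ℝ≥0 → Ω → ℕ}
    (hN : IsUnitPoissonProcess P N) {a b : ℝ≥0} (hab : a ≤ b) :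
    ∫⁻ ω, ((N b ω - N a ω : ℕ) : ENNReal) ∂P = (b - a : ℝ≥0) := by
  rw [← lintegral_natCast_poissonMeasure, ← hN.map_increment a b hab,
    lintegral_map .of_discrete (f := fun n : ℕ => (n : ENNReal))
      (g := fun ω => N b ω - N a ω) ((hN.measurable b).sub (hN.measurable a))]

/-- Telescoping over grid cells. The increment over a cell is multiplied by an event about the left
end of that cell, which is the form in which independence applies. -/
theorem natCast_gridPt_eq_tsum {p : ℝ≥0 → ℕ} (hp : Monotone p) (h0 : p 0 = 0) (m : ℕ) (u : ℝ≥0) :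
    (p (gridPt m u) : ENNReal) = ∑' j : ℕ, {v : ℝ≥0 | (j : ℝ≥0) / ((m : ℝ≥0) + 1) ≤ v}.indicator 1 u *
      ((p ((j + 1 : ℕ) / ((m : ℝ≥0) + 1)) - p ((j : ℝ≥0) / ((m : ℝ≥0) + 1)) : ℕ) : ENNReal) := by
  have hmem : ∀ j : ℕ, (j : ℝ≥0) / ((m : ℝ≥0) + 1) ≤ u ↔ j ∈ Finset.range (⌊u * ((m : ℝ≥0) + 1)⌋₊ + 1) := by
    intro j
    rw [div_le_iff₀ (by positivity), Finset.mem_range, Nat.lt_succ_iff, Nat.le_floor_iff (by positivity)]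
  rw [tsum_eq_sum (s := Finset.range (⌊u * ((m : ℝ≥0) + 1)⌋₊ + 1))
    (fun j hj => by rw [indicator_of_notMem (by simpa [hmem] using hj), zero_mul])]
  rw [Finset.sum_congr rfl (fun j hj => by
    rw [indicator_of_mem (s := {v : ℝ≥0 | (j : ℝ≥0) / ((m : ℝ≥0) + 1) ≤ v}) ((hmem j).2 hj),
      Pi.one_apply, one_mul])]
  rw [← Nat.cast_sum, Finset.sum_range_tsub (f := fun j : ℕ => p ((j : ℝ≥0) / ((m : ℝ≥0) + 1)))
    (fun i j hij => hp (by gcongr))]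
  simp [gridPt, h0]

theorem gridPt_eq_tsum (m : ℕ) (u : ℝ≥0) :
    (gridPt m u : ENNReal) = ∑' j : ℕ, {v : ℝ≥0 | (j : ℝ≥0) / ((m : ℝ≥0) + 1) ≤ v}.indicator 1 u *
      ((((j + 1 : ℕ) / ((m : ℝ≥0) + 1) : ℝ≥0) - ((j : ℝ≥0) / ((m : ℝ≥0) + 1)) : ℝ≥0) : ENNReal) := by
  have hmem : ∀ j : ℕ, (j : ℝ≥0) / ((m : ℝ≥0) + 1) ≤ u ↔ j ∈ Finset.range (⌊u * ((m : ℝ≥0) + 1)⌋₊ + 1) := by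
    intro j
    rw [div_le_iff₀ (by positivity), Finset.mem_range, Nat.lt_succ_iff, Nat.le_floor_iff (by positivity)]
  rw [tsum_eq_sum (s := Finset.range (⌊u * ((m : ℝ≥0) + 1)⌋₊ + 1))
    (fun j hj => by rw [indicator_of_notMem (by simpa [hmem] using hj), zero_mul])]
  rw [Finset.sum_congr rfl (fun j hj => by
    rw [indicator_of_mem (s := {v : ℝ≥0 | (j : ℝ≥0) / ((m : ℝ≥0) + 1) ≤ v}) ((hmem j).2 hj),
      Pi.one_apply, one_mul])]
  rw [← ENNReal.ofNNReal_finsetSum, Finset.sum_range_tsub (f := fun j : ℕ => (j : ℝ≥0) / ((m : ℝ≥0) + 1))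
    (fun i j hij => by dsimp only; gcongr)]
  simp [gridPt]

/-- Optional stopping on the grid: the expectation of `N` at the grid point to the right of `v`. -/
theorem IsUnitPoissonProcess.lintegral_gridPt {N : ℝ≥0 → Ω → ℕ}
    (hN : IsUnitPoissonProcess P N) {v : Ω → ℝ≥0} (hv : AEMeasurable v P)
    (hind : ∀ a b : ℝ≥0, a ≤ b → ∃ S, MeasurableSet S ∧ S =ᵐ[P] {ω | a ≤ v ω} ∧
      IndepFun (S.indicator (1 : Ω → ENNReal)) (fun ω => N b ω - N a ω) P) (m : ℕ) :
    ∫⁻ ω, (N (gridPt m (v ω)) ω : ENNReal) ∂P = ∫⁻ ω, (gridPt m (v ω) : ENNReal) ∂P := by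
  have key : ∀ a b : ℝ≥0, a ≤ b →
      ∫⁻ ω, {x : ℝ≥0 | a ≤ x}.indicator 1 (v ω) * ((N b ω - N a ω : ℕ) : ENNReal) ∂P =
        ∫⁻ ω, {x : ℝ≥0 | a ≤ x}.indicator 1 (v ω) * ((b - a : ℝ≥0) : ENNReal) ∂P := by
    intro a b hab
    obtain ⟨S, hSm, hS, hi⟩ := hind a b hab
    have e : (fun ω => {x : ℝ≥0 | a ≤ x}.indicator (1 : ℝ≥0 → ENNReal) (v ω)) =ᵐ[P]
        S.indicator (1 : Ω → ENNReal) := by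
      filter_upwards [hS.mem_iff] with ω hω
      simp only [indicator, mem_ofPred_eq, Pi.one_apply] at hω ⊢
      simp only [hω]
    refine (lintegral_congr_ae (e.mul (ae_eq_refl _))).trans (Eq.trans ?_
      (lintegral_congr_ae (e.mul (ae_eq_refl _))).symm)
    have hsm : Measurable (S.indicator (1 : Ω → ENNReal)) := measurable_one.indicator hSm
    have hDm : Measurable fun ω => ((N b ω - N a ω : ℕ) : ENNReal) :=
      (Measurable.of_discrete (f := fun n : ℕ => (n : ENNReal))).comp
        ((hN.measurable b).sub (hN.measurable a))
    have h1 := lintegral_mul_eq_lintegral_mul_lintegral_of_indepFun hsm hDm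
      (hi.comp measurable_id (.of_discrete (f := fun n : ℕ => (n : ENNReal))))
    refine h1.trans ?_
    rw [hN.lintegral_increment hab]
    exact (lintegral_mul_const _ hsm).symm
  have hvm : ∀ a : ℝ≥0, AEMeasurable (fun ω => {x : ℝ≥0 | a ≤ x}.indicator (1 : ℝ≥0 → ENNReal) (v ω)) P :=
    fun a => (measurable_one.indicator measurableSet_Ici).comp_aemeasurable hv
  have hNm : ∀ a b : ℝ≥0, AEMeasurable (fun ω => ((N b ω - N a ω : ℕ) : ENNReal)) P := fun a b =>
    ((Measurable.of_discrete (f := fun n : ℕ => (n : ENNReal))).comp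
      ((hN.measurable b).sub (hN.measurable a))).aemeasurable
  have e1 : ∫⁻ ω, (N (gridPt m (v ω)) ω : ENNReal) ∂P = ∫⁻ ω, ∑' j : ℕ,
      {x : ℝ≥0 | (j : ℝ≥0) / ((m : ℝ≥0) + 1) ≤ x}.indicator 1 (v ω) *
      ((N ((j + 1 : ℕ) / ((m : ℝ≥0) + 1)) ω - N ((j : ℝ≥0) / ((m : ℝ≥0) + 1)) ω : ℕ) : ENNReal) ∂P := by
    refine lintegral_congr_ae ?_
    filter_upwards [hN.zero, hN.monotone] with ω h1 h2
    exact natCast_gridPt_eq_tsum h2 h1 m (v ω)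
  simp_rw [e1, gridPt_eq_tsum]
  rw [lintegral_tsum, lintegral_tsum]
  rotate_left
  · exact fun j => (hvm _).mul aemeasurable_const
  · exact fun j => (hvm _).mul (hNm _ _)
  exact tsum_congr fun j => key _ _ (by gcongr; simp)

/-- Optional stopping: a unit Poisson process evaluated at an integrable stopping time `v` has the
mean of `v`. -/
theorem IsUnitPoissonProcess.lintegral_stopped [IsProbabilityMeasure P] {N : ℝ≥0 → Ω → ℕ}
    (hN : IsUnitPoissonProcess P N) {v : Ω → ℝ≥0} (hv : AEMeasurable v P)
    (hfin : ∫⁻ ω, (v ω : ENNReal) ∂P ≠ ⊤)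
    (hind : ∀ a b : ℝ≥0, a ≤ b → ∃ S, MeasurableSet S ∧ S =ᵐ[P] {ω | a ≤ v ω} ∧
      IndepFun (S.indicator (1 : Ω → ENNReal)) (fun ω => N b ω - N a ω) P) :
    ∫⁻ ω, (N (v ω) ω : ENNReal) ∂P = ∫⁻ ω, (v ω : ENNReal) ∂P := by
  have hbound : ∫⁻ ω, (gridPt 0 (v ω) : ENNReal) ∂P ≠ ⊤ := by
    refine ne_top_of_le_ne_top ?_ (lintegral_mono fun ω => ENNReal.coe_le_coe.2 (gridPt_le 0 (v ω)))
    simp only [ENNReal.coe_add]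
    rw [lintegral_add_right _ measurable_const]
    simp [hfin]
  have hgm : ∀ m, AEMeasurable (fun ω => gridPt m (v ω)) P := fun m =>
    (measurable_gridPt m).comp_aemeasurable hv
  have hNm : Measurable fun ω t => N t ω := measurable_pi_lambda _ fun t => hN.measurable t
  have hcast : Measurable fun n : ℕ => (n : ENNReal) := .of_discrete
  have hNgm : ∀ m, AEMeasurable (fun ω => (N (gridPt m (v ω)) ω : ENNReal)) P := by
    intro m
    refine hcast.comp_aemeasurable (AEMeasurable.congr (f := fun ω => pathEval (fun t => N t ω)
      (gridPt m (v ω))) (measurable_pathEval.comp_aemeasurable (hNm.aemeasurable.prodMk (hgm m))) ?_)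
    filter_upwards [hN.ae_isCountingPath] with ω h using h.pathEval_eq _
  have l1 : Tendsto (fun m => ∫⁻ ω, (N (gridPt m (v ω)) ω : ENNReal) ∂P) atTop
      (𝓝 (∫⁻ ω, (N (v ω) ω : ENNReal) ∂P)) := by
    refine tendsto_lintegral_of_dominated_convergence' (fun ω => (N (gridPt 0 (v ω)) ω : ENNReal))
      hNgm (fun m => ?_) ?_ ?_
    · filter_upwards [hN.monotone] with ω h
      exact Nat.cast_le.2 (h (gridPt_le_gridPt_zero m _))
    · rwa [hN.lintegral_gridPt hv hind]
    · filter_upwards [hN.ae_isCountingPath] with ω h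
      refine tendsto_const_nhds.congr' ?_
      filter_upwards [(tendsto_gridPt (v ω)).eventually (h.eventually_eq _)] with m hm
      rw [hm]
  have l2 : Tendsto (fun m => ∫⁻ ω, (gridPt m (v ω) : ENNReal) ∂P) atTop
      (𝓝 (∫⁻ ω, (v ω : ENNReal) ∂P)) := by
    refine tendsto_lintegral_of_dominated_convergence' (fun ω => (gridPt 0 (v ω) : ENNReal))
      (fun m => (hgm m).coe_nnreal_ennreal) (fun m => .of_forall fun ω => ?_) hbound
      (.of_forall fun ω => ?_)
    · exact ENNReal.coe_le_coe.2 (gridPt_le_gridPt_zero m _)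
    · exact ENNReal.tendsto_coe.2 ((tendsto_gridPt (v ω)).mono_right nhdsWithin_le_nhds)
  refine tendsto_nhds_unique l1 (l2.congr fun m => ?_)
  rw [hN.lintegral_gridPt hv hind]

end

/-! ### The law of large numbers for Poisson paths, and Grönwall's inequality -/

section

variable {Ω : Type*} [MeasurableSpace Ω] {P : Measure Ω}

/-- The strong law of large numbers for a Poisson process along the integers. -/
theorem IsUnitPoissonProcess.tendsto_div_nat [IsProbabilityMeasure P] {N : ℝ≥0 → Ω → ℕ}
    (hN : IsUnitPoissonProcess P N) :
    ∀ᵐ ω ∂P, Tendsto (fun n : ℕ => (N n ω : ℝ) / n) atTop (𝓝 1) := by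
  set X : ℕ → Ω → ℝ := fun j ω => ((N ((j + 1 : ℕ) : ℝ≥0) ω - N (j : ℝ≥0) ω : ℕ) : ℝ)
  have hDm : ∀ j : ℕ, Measurable fun ω => N ((j + 1 : ℕ) : ℝ≥0) ω - N (j : ℝ≥0) ω := fun j =>
    (hN.measurable _).sub (hN.measurable _)
  have hcast : Measurable fun n : ℕ => (n : ℝ) := .of_discrete
  have hXm : ∀ j, Measurable (X j) := fun j => hcast.comp (hDm j)
  have hlaw : ∀ j : ℕ, P.map (fun ω => N ((j + 1 : ℕ) : ℝ≥0) ω - N (j : ℝ≥0) ω) =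
      poissonMeasure 1 := by
    intro j
    rw [hN.map_increment _ _ (by simp)]
    congr
    simp
  have hid : ∀ j, IdentDistrib (X j) (X 0) P P := by
    intro j
    have : IdentDistrib (fun ω => N ((j + 1 : ℕ) : ℝ≥0) ω - N (j : ℝ≥0) ω)
        (fun ω => N ((0 + 1 : ℕ) : ℝ≥0) ω - N ((0 : ℕ) : ℝ≥0) ω) P P :=
      ⟨(hDm j).aemeasurable, (hDm 0).aemeasurable, by rw [hlaw j, hlaw 0]⟩
    exact this.comp hcast
  have hl : ∫⁻ ω, ENNReal.ofReal (X 0 ω) ∂P = 1 := by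
    have := hN.lintegral_increment (a := ((0 : ℕ) : ℝ≥0)) (b := ((0 + 1 : ℕ) : ℝ≥0)) (by simp)
    simpa [X] using this
  have hint : Integrable (X 0) P := by
    refine ⟨(hXm 0).aestronglyMeasurable, ?_⟩
    rw [hasFiniteIntegral_iff_ofReal (.of_forall fun ω => by simp [X]), hl]
    exact ENNReal.one_lt_top
  have hmean : ∫ ω, X 0 ω ∂P = 1 := by
    rw [integral_eq_lintegral_of_nonneg_ae (.of_forall fun ω => by simp [X])
      (hXm 0).aestronglyMeasurable, hl, ENNReal.toReal_one]
  have hind : iIndepFun X P :=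
    (hN.indepIncrements.nat (t := fun n : ℕ => (n : ℝ≥0)) Nat.mono_cast).comp
      (fun _ n => (n : ℝ)) (fun _ => hcast)
  have hslln := strong_law_ae_real X hint (fun i j hij => hind.indepFun hij) hid
  filter_upwards [hslln, hN.zero, hN.monotone] with ω h h0 hmono
  rw [hmean] at h
  refine h.congr fun n => ?_
  simp only [X]
  rw [← Nat.cast_sum, Finset.sum_range_tsub (f := fun j : ℕ => N (j : ℝ≥0) ω)
    (fun i j hij => hmono (Nat.mono_cast hij))]
  simp [h0]

/-- Only finitely many indices escape the bound `ε * n`; the sum of their deviations is the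
constant. -/
theorem exists_abs_sub_natCast_le {x : ℕ → ℝ} (hx : Tendsto (fun n : ℕ => x n / n) atTop (𝓝 1))
    {ε : ℝ} (hε : 0 < ε) : ∃ C : ℝ, 0 ≤ C ∧ ∀ n : ℕ, |x n - n| ≤ ε * n + C := by
  obtain ⟨n₀, hn₀⟩ := Metric.tendsto_atTop.1 hx ε hε
  refine ⟨∑ i ∈ Finset.range (n₀ + 1), |x i - i|, Finset.sum_nonneg fun _ _ => abs_nonneg _,
    fun n => ?_⟩
  rcases le_or_gt n n₀ with hn | hn
  · have := Finset.single_le_sum (f := fun i : ℕ => |x i - i|) (fun _ _ => abs_nonneg _)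
      (Finset.mem_range.2 (Nat.lt_succ_of_le hn))
    have h2 : 0 ≤ ε * n := by positivity
    linarith
  · have hpos : (0 : ℝ) < n := by exact_mod_cast (Nat.zero_le n₀).trans_lt hn
    have h1 := (hn₀ n hn.le).le
    rw [Real.dist_eq, div_sub_one hpos.ne', abs_div, abs_of_pos hpos, div_le_iff₀ hpos] at h1
    have h2 : 0 ≤ ∑ i ∈ Finset.range (n₀ + 1), |x i - i| := Finset.sum_nonneg fun _ _ => abs_nonneg _
    linarith

/-- Almost surely, a Poisson path stays within any linear cone around its mean, up to a
constant. -/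
theorem IsUnitPoissonProcess.ae_abs_sub_le [IsProbabilityMeasure P] {N : ℝ≥0 → Ω → ℕ}
    (hN : IsUnitPoissonProcess P N) :
    ∀ᵐ ω ∂P, ∀ ε : ℝ, 0 < ε → ∃ C : ℝ, 0 ≤ C ∧ ∀ s : ℝ≥0, |(N s ω : ℝ) - s| ≤ ε * s + C := by
  filter_upwards [hN.tendsto_div_nat, hN.monotone] with ω h hmono ε hε
  obtain ⟨C, hC0, hC⟩ := exists_abs_sub_natCast_le h hε
  -- Monotonicity puts `N s` between its values at `⌊s⌋₊` and `⌊s⌋₊ + 1`; rounding costs `1` in the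
  -- mean and `ε` in the cone.
  refine ⟨C + ε + 1, by positivity, fun s => ?_⟩
  have h1 : ((⌊s⌋₊ : ℝ≥0) : ℝ) ≤ s := by exact_mod_cast Nat.floor_le (zero_le : 0 ≤ s)
  have h2 : (s : ℝ) < (⌊s⌋₊ : ℝ) + 1 := by exact_mod_cast Nat.lt_floor_add_one s
  have h3 : (N (⌊s⌋₊ : ℝ≥0) ω : ℝ) ≤ N s ω :=
    Nat.cast_le.2 (hmono (Nat.floor_le (zero_le : 0 ≤ s)))
  have h4 : (N s ω : ℝ) ≤ N ((⌊s⌋₊ + 1 : ℕ) : ℝ≥0) ω := by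
    refine Nat.cast_le.2 (hmono ?_)
    exact_mod_cast (Nat.lt_floor_add_one s).le
  have h5 := abs_le.1 (hC ⌊s⌋₊)
  have h6 := abs_le.1 (hC (⌊s⌋₊ + 1))
  push_cast at h1 h4 h5 h6
  rw [abs_le]
  constructor <;> nlinarith

/-- Grönwall's inequality in integral form, for a bounded function. -/
theorem le_mul_exp_of_le_add_integral {T a b S : ℝ} (ha : 0 ≤ a) (hb : 0 ≤ b) {φ : ℝ → ℝ}
    (hφ : IntegrableOn φ (Icc 0 T)) (hS : ∀ t ∈ Icc 0 T, φ t ≤ S)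
    (h : ∀ t ∈ Icc 0 T, φ t ≤ a + b * ∫ s in (0 : ℝ)..t, φ s) :
    ∀ t ∈ Icc 0 T, φ t ≤ a * Real.exp (b * t) := by
  -- The bounds obtained by iterating the inequality from `S`: `G (n + 1)` has derivative `b * G n`
  -- and value `a` at `0`, and its `S` term vanishes as `n → ∞`.
  set G : ℕ → ℝ → ℝ := fun n t => a * Real.exp (b * t) + S * ((b * t) ^ n / n.factorial)
  have hG : ∀ n, Continuous (G n) := fun n => by fun_prop
  have hG0 : ∀ n, G (n + 1) 0 = a := fun n => by simp [G]
  have hderiv : ∀ n t, HasDerivAt (G (n + 1)) (b * G n t) t := by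
    intro n t
    have h1 : HasDerivAt (fun t : ℝ => b * t) b t := by simpa using (hasDerivAt_id t).const_mul b
    have h2 := ((h1.exp).const_mul a).add (((h1.pow (n + 1)).div_const ((n + 1).factorial : ℝ)).const_mul S)
    refine h2.congr_deriv ?_
    have : ((n : ℝ) + 1) ≠ 0 := by positivity
    have : (n.factorial : ℝ) ≠ 0 := by positivity
    simp only [G, Nat.factorial_succ]
    push_cast
    field_simp
  have key : ∀ n : ℕ, ∀ t ∈ Icc 0 T, φ t ≤ G n t := by
    intro n
    induction n with
    | zero =>
      intro t ht
      have : 0 ≤ a * Real.exp (b * t) := by positivity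
      simpa [G] using (hS t ht).trans (by linarith)
    | succ n ih =>
      intro t ht
      have hmono := intervalIntegral.integral_mono_on ht.1
        ((intervalIntegrable_iff_integrableOn_Icc_of_le ht.1).2
          (hφ.mono_set (Icc_subset_Icc_right ht.2)))
        ((hG n).intervalIntegrable 0 t) (fun s hs => ih s ⟨hs.1, hs.2.trans ht.2⟩)
      have hint := intervalIntegral.integral_eq_sub_of_hasDerivAt
        (fun s _ => hderiv n s) (((hG n).const_mul b).intervalIntegrable 0 t)
      rw [intervalIntegral.integral_const_mul, hG0] at hint
      have := mul_le_mul_of_nonneg_left hmono hb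
      linarith [h t ht]
  intro t ht
  have l1 : Tendsto (fun n : ℕ => G n t) atTop (𝓝 (a * Real.exp (b * t) + S * 0)) :=
    tendsto_const_nhds.add ((FloorSemiring.tendsto_pow_div_factorial_atTop (b * t)).const_mul _)
  simpa using ge_of_tendsto' l1 fun n => key n t ht

end

theorem measurable_setIntegral_Ioc {α : Type*} [MeasurableSpace α] {F : α × ℝ → ℝ}
    (hF : Measurable F) : Measurable fun x : α × ℝ => ∫ r in Ioc 0 x.2, F (x.1, r) := by
  have h : Measurable fun z : (α × ℝ) × ℝ =>
      {z : (α × ℝ) × ℝ | z.2 ∈ Ioc 0 z.1.2}.indicator (fun z => F (z.1.1, z.2)) z := by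
    refine Measurable.indicator (by fun_prop) ?_
    exact (measurableSet_lt measurable_const measurable_snd).inter
      (measurableSet_le measurable_snd (measurable_snd.comp measurable_fst))
  have h2 := h.stronglyMeasurable.integral_prod_right' (ν := volume)
  convert h2.measurable using 2 with x
  rw [← integral_indicator measurableSet_Ioc]
  rfl

/-! ### Clocks rebuilt from the driving paths -/

section

variable {k : ℕ}

/-- The counts shown by the counting paths `y` when their clocks read `v`. -/
noncomputable def counts (y : Fin k → ℝ≥0 → ℕ) (v : Fin k → ℝ) : Fin k → ℕ :=
  fun j => pathEval (y j) (v j).toNNReal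

theorem measurable_counts {α : Type*} [MeasurableSpace α] {y : α → Fin k → ℝ≥0 → ℕ}
    {v : α → Fin k → ℝ} (hy : Measurable y) (hv : ∀ j, Measurable fun x => v x j) :
    Measurable fun x => counts (y x) (v x) := by
  refine measurable_pi_lambda _ fun j => ?_
  exact measurable_pathEval.comp (((measurable_pi_apply j).comp hy).prodMk (hv j).real_toNNReal)

theorem counts_eq {y : Fin k → ℝ≥0 → ℕ} (hy : ∀ j, IsCountingPath (y j)) (v : Fin k → ℝ) (j : Fin k) :
    counts y v j = y j (v j).toNNReal := (hy j).pathEval_eq _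

theorem counts_mono {y : Fin k → ℝ≥0 → ℕ} (hy : ∀ j, IsCountingPath (y j)) {v w : Fin k → ℝ}
    (h : v ≤ w) : counts y v ≤ counts y w := fun j => by
  rw [counts_eq hy, counts_eq hy]
  exact (hy j).mono (Real.toNNReal_le_toNNReal (h j))

/-- Jump rates depending on the counts and on time, of linear growth. -/
structure IsRateFamily (ρ : Fin k → (Fin k → ℕ) → ℝ → ℝ) (K : ℝ) : Prop where
  measurable : ∀ j c, Measurable (ρ j c)
  nonneg : ∀ j c s, 0 ≤ ρ j c s
  le : ∀ j c s, ρ j c s ≤ K * (1 + ∑ i, (c i : ℝ))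

variable {ρ : Fin k → (Fin k → ℕ) → ℝ → ℝ} {K : ℝ}

/-- Count vectors form a countable space, so measurability in time for each fixed vector gives joint
measurability. -/
theorem IsRateFamily.measurable_comp {α : Type*} [MeasurableSpace α] (hρ : IsRateFamily ρ K)
    (j : Fin k) {c : α → Fin k → ℕ} {s : α → ℝ} (hc : Measurable c) (hs : Measurable s) :
    Measurable fun x => ρ j (c x) (s x) := by
  have : Measurable fun z : (Fin k → ℕ) × ℝ => ρ j z.1 z.2 :=
    measurable_from_prod_countable_right fun c => hρ.measurable j c
  exact this.comp (hc.prodMk hs)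

/-- Clocks running at the rates `ρ`, for the counts shown by the clocks `u`. -/
noncomputable def runClock (ρ : Fin k → (Fin k → ℕ) → ℝ → ℝ) (y : Fin k → ℝ≥0 → ℕ)
    (u : ℝ → Fin k → ℝ) (t : ℝ) : Fin k → ℝ :=
  fun j => ∫ s in Ioc 0 t, ρ j (counts y (u s)) s

/-- Picard approximation of the clocks, frozen when the total count reaches `n`. -/
noncomputable def frozenClock (ρ : Fin k → (Fin k → ℕ) → ℝ → ℝ) (y : Fin k → ℝ≥0 → ℕ) :
    ℕ → ℝ → Fin k → ℝ
  | 0, _ => 0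
  | n + 1, t => fun j => ∫ s in Ioc 0 t,
      -- The previous stage stands still once the total reaches `n`, so it may miss the next jump.
      -- Its `runClock` keeps going at the correct rates and is exact up to the moment when the
      -- total reaches `n + 1`.
      if ∑ i, counts y (runClock ρ y (frozenClock ρ y n) s) i < n + 1
      then ρ j (counts y (frozenClock ρ y n s)) s else 0

theorem measurable_runClock (hρ : IsRateFamily ρ K) {u : (Fin k → ℝ≥0 → ℕ) → ℝ → Fin k → ℝ}
    (hu : ∀ j, Measurable fun z : (Fin k → ℝ≥0 → ℕ) × ℝ => u z.1 z.2 j) (j : Fin k) :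
    Measurable fun z : (Fin k → ℝ≥0 → ℕ) × ℝ => runClock ρ z.1 (u z.1) z.2 j :=
  measurable_setIntegral_Ioc
    (F := fun z : (Fin k → ℝ≥0 → ℕ) × ℝ => ρ j (counts z.1 (u z.1 z.2)) z.2)
    (hρ.measurable_comp j (measurable_counts measurable_fst hu) measurable_snd)

theorem measurable_frozenClock (hρ : IsRateFamily ρ K) (n : ℕ) (j : Fin k) :
    Measurable fun z : (Fin k → ℝ≥0 → ℕ) × ℝ => frozenClock ρ z.1 n z.2 j := by
  induction n generalizing j with
  | zero => exact measurable_const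
  | succ n ih =>
    refine measurable_setIntegral_Ioc (F := fun z : (Fin k → ℝ≥0 → ℕ) × ℝ =>
      if ∑ i, counts z.1 (runClock ρ z.1 (frozenClock ρ z.1 n) z.2) i < n + 1
      then ρ j (counts z.1 (frozenClock ρ z.1 n z.2)) z.2 else 0) ?_
    have h1 := measurable_counts measurable_fst (measurable_runClock (u := fun y => frozenClock ρ y n) hρ ih)
    have h2 : Measurable fun z : (Fin k → ℝ≥0 → ℕ) × ℝ =>
        ∑ i, counts z.1 (runClock ρ z.1 (frozenClock ρ z.1 n) z.2) i :=
      Finset.measurable_sum _ fun i _ => (measurable_pi_apply i).comp h1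
    exact Measurable.ite (measurableSet_lt h2 measurable_const)
      (hρ.measurable_comp j (measurable_counts measurable_fst ih) measurable_snd) measurable_const

theorem IsRateFamily.integrableOn_of_monotone (hρ : IsRateFamily ρ K) {y : Fin k → ℝ≥0 → ℕ}
    (hy : ∀ j, IsCountingPath (y j)) {u : ℝ → Fin k → ℝ} (hu : Monotone u) (j : Fin k) (t : ℝ) :
    IntegrableOn (fun s => ρ j (counts y (u s)) s) (Ioc 0 t) := by
  have hm : Measurable fun s => ρ j (counts y (u s)) s :=
    hρ.measurable_comp j (measurable_counts measurable_const
      fun j => Monotone.measurable fun _ _ h => hu h j) measurable_id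
  have hK : 0 ≤ K := by
    have h1 := (hρ.nonneg j 0 0).trans (hρ.le j 0 0)
    simpa using h1
  refine Measure.integrableOn_of_bounded (M := K * (1 + ∑ i, (counts y (u t) i : ℝ))) (by simp)
    hm.aestronglyMeasurable ?_
  refine (ae_restrict_iff' measurableSet_Ioc).2 (.of_forall fun s hs => ?_)
  rw [Real.norm_of_nonneg (hρ.nonneg _ _ _)]
  refine (hρ.le j _ s).trans ?_
  gcongr with i
  exact counts_mono hy (hu hs.2) i

theorem setIntegral_Ioc_mono_right {g : ℝ → ℝ} (hg : ∀ s, 0 ≤ g s)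
    (hi : ∀ t, IntegrableOn g (Ioc 0 t)) : Monotone fun t => ∫ s in Ioc 0 t, g s := fun _ t h =>
  setIntegral_mono_set (hi t) (.of_forall hg) (Ioc_subset_Ioc_right h).eventuallyLE

theorem runClock_mono (hρ : IsRateFamily ρ K) {y : Fin k → ℝ≥0 → ℕ}
    (hy : ∀ j, IsCountingPath (y j)) {u : ℝ → Fin k → ℝ} (hu : Monotone u) :
    Monotone (runClock ρ y u) := fun _ _ h j =>
  setIntegral_Ioc_mono_right (fun s => hρ.nonneg j _ s)
    (fun t => hρ.integrableOn_of_monotone hy hu j t) h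

theorem frozenClock_mono (hρ : IsRateFamily ρ K) {y : Fin k → ℝ≥0 → ℕ}
    (hy : ∀ j, IsCountingPath (y j)) (n : ℕ) : Monotone (frozenClock ρ y n) := by
  induction n with
  | zero => exact monotone_const
  | succ n ih =>
    intro t t' h j
    refine setIntegral_Ioc_mono_right (fun s => ?_) (fun t => ?_) h
    · split_ifs
      exacts [hρ.nonneg j _ s, le_rfl]
    · have hc : Measurable fun s => ∑ i, counts y (runClock ρ y (frozenClock ρ y n) s) i :=
        Finset.measurable_sum _ fun i _ => (measurable_pi_apply i).comp
          (measurable_counts measurable_const fun j =>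
            Monotone.measurable fun _ _ h => runClock_mono hρ hy ih h j)
      refine ((hρ.integrableOn_of_monotone hy ih j t).indicator
        (measurableSet_lt hc (measurable_const (a := n + 1)))).congr (.of_forall fun s => ?_)
      simp only [indicator_apply, mem_ofPred_eq]

/-! ### Pathwise identification of the frozen clocks with a stopped solution -/

/-- `τ` are the internal clocks of the counting process driven by `y` with rates `ρ`. -/
structure IsClockSolution (ρ : Fin k → (Fin k → ℕ) → ℝ → ℝ) (y : Fin k → ℝ≥0 → ℕ)
    (τ : ℝ → Fin k → ℝ) : Prop where
  path : ∀ j, IsCountingPath (y j)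
  integrable : ∀ j, Integrable fun s => ρ j (counts y (τ s)) s
  eq : ∀ t, τ t = runClock ρ y τ t

/-- The clocks of a solution, stopped when the total count reaches `n`. -/
noncomputable def stoppedClock (ρ : Fin k → (Fin k → ℕ) → ℝ → ℝ) (y : Fin k → ℝ≥0 → ℕ)
    (τ : ℝ → Fin k → ℝ) (n : ℕ) (t : ℝ) : Fin k → ℝ :=
  fun j => ∫ s in Ioc 0 t, if ∑ i, counts y (τ s) i < n then ρ j (counts y (τ s)) s else 0

/-- By right-continuity, the infimum of the times at level `n` or above is itself such a time. -/
theorem exists_first_le {A : ℝ → ℕ} (hA : ∀ t, ∀ᶠ s in 𝓝[≥] t, A s = A t)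
    {n : ℕ} {s₀ r : ℝ} (h0 : ∀ s ≤ s₀, A s < n) (hr : n ≤ A r) :
    ∃ t ≤ r, n ≤ A t ∧ ∀ s < t, A s < n := by
  set S := {s | n ≤ A s}
  have hbdd : BddBelow S := ⟨s₀, fun s hs => by
    by_contra! h
    exact absurd hs (not_le.2 (h0 s h.le))⟩
  refine ⟨sInf S, csInf_le hbdd hr, ?_, fun s hs => ?_⟩
  · have hfreq : ∃ᶠ s in 𝓝[≥] sInf S, s ∈ S := by
      have := mem_closure_iff_frequently.1 (csInf_mem_closure ⟨r, hr⟩ hbdd)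
      rw [frequently_nhdsWithin_iff]
      exact this.mono fun s hs => ⟨hs, csInf_le hbdd hs⟩
    obtain ⟨s, hs, he⟩ := (hfreq.and_eventually (hA _)).exists
    rw [← he]
    exact hs
  · by_contra! h
    exact absurd (csInf_le hbdd h) (not_le.2 hs)

namespace IsClockSolution

variable {y : Fin k → ℝ≥0 → ℕ} {τ : ℝ → Fin k → ℝ}

theorem apply_eq (h : IsClockSolution ρ y τ) (t : ℝ) (j : Fin k) :
    τ t j = ∫ s in Ioc 0 t, ρ j (counts y (τ s)) s := by
  conv_lhs => rw [h.eq t]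
  rfl

theorem mono (h : IsClockSolution ρ y τ) (hρ : IsRateFamily ρ K) : Monotone τ := by
  intro s t hst j
  rw [h.apply_eq, h.apply_eq]
  exact setIntegral_Ioc_mono_right (fun s => hρ.nonneg j _ s)
    (fun t => (h.integrable j).integrableOn) hst

theorem nonpos (h : IsClockSolution ρ y τ) {t : ℝ} (ht : t ≤ 0) : τ t = 0 := by
  ext j
  rw [h.apply_eq, Ioc_eq_empty (not_lt.2 ht)]
  simp

theorem continuous_stoppedIntegral {g : ℝ → ℝ} (hg : Integrable g) :
    Continuous fun t => ∫ s in Ioc 0 t, g s := by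
  have h1 : Continuous fun t => ∫ s in (0 : ℝ)..(max 0 t), g s :=
    (intervalIntegral.continuous_primitive (fun a b => hg.intervalIntegrable) 0).comp
      (continuous_const.max continuous_id)
  refine h1.congr fun t => ?_
  rw [intervalIntegral.integral_of_le (le_max_left _ _)]
  congr 2
  ext s
  simp only [mem_Ioc, le_max_iff]
  constructor
  · rintro ⟨h, h' | h'⟩
    · linarith
    · exact ⟨h, h'⟩
  · exact fun ⟨h, h'⟩ => ⟨h, .inr h'⟩

theorem continuous (h : IsClockSolution ρ y τ) (j : Fin k) : Continuous fun t => τ t j := by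
  simp only [h.apply_eq]
  exact continuous_stoppedIntegral (h.integrable j)

theorem counts_mono (h : IsClockSolution ρ y τ) (hρ : IsRateFamily ρ K) :
    Monotone fun t => counts y (τ t) := fun _ _ hst => _root_.counts_mono h.path (h.mono hρ hst)

theorem sum_counts_mono (h : IsClockSolution ρ y τ) (hρ : IsRateFamily ρ K) :
    Monotone fun t => ∑ i, counts y (τ t) i := fun _ _ hst =>
  Finset.sum_le_sum fun i _ => h.counts_mono hρ hst i

theorem counts_of_nonpos (h : IsClockSolution ρ y τ) {t : ℝ} (ht : t ≤ 0) :
    counts y (τ t) = 0 := by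
  ext j
  rw [counts_eq h.path, h.nonpos ht]
  simp [(h.path j).zero]

theorem eventually_counts_eq (h : IsClockSolution ρ y τ) (hρ : IsRateFamily ρ K) (t : ℝ) :
    ∀ᶠ s in 𝓝[≥] t, ∑ i, counts y (τ s) i = ∑ i, counts y (τ t) i := by
  have h1 : ∀ j, ∀ᶠ s in 𝓝[≥] t, counts y (τ s) j = counts y (τ t) j := by
    intro j
    have h2 : Tendsto (fun s => (τ s j).toNNReal) (𝓝[≥] t) (𝓝[≥] (τ t j).toNNReal) := by
      refine tendsto_nhdsWithin_iff.2 ⟨?_, ?_⟩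
      · exact ((continuous_real_toNNReal.comp (h.continuous j)).tendsto t).mono_left
          nhdsWithin_le_nhds
      · filter_upwards [self_mem_nhdsWithin] with s hs
        exact Real.toNNReal_le_toNNReal (h.mono hρ hs j)
    filter_upwards [h2.eventually ((h.path j).eventually_eq _)] with s hs
    rw [counts_eq h.path, counts_eq h.path, hs]
  filter_upwards [eventually_all.2 h1] with s hs
  exact Finset.sum_congr rfl fun j _ => hs j

theorem exists_hitting (h : IsClockSolution ρ y τ) (hρ : IsRateFamily ρ K) {n : ℕ} (hn : 0 < n)
    {r : ℝ} (hr : n ≤ ∑ i, counts y (τ r) i) :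
    ∃ t ≤ r, n ≤ ∑ i, counts y (τ t) i ∧ ∀ s < t, ∑ i, counts y (τ s) i < n :=
  exists_first_le (A := fun s => ∑ i, counts y (τ s) i) (h.eventually_counts_eq hρ) (s₀ := 0)
    (fun s hs => by simpa [h.counts_of_nonpos hs] using hn) hr

theorem integrable_stopped (h : IsClockSolution ρ y τ) (hρ : IsRateFamily ρ K) (n : ℕ)
    (j : Fin k) :
    Integrable fun s => if ∑ i, counts y (τ s) i < n then ρ j (counts y (τ s)) s else 0 :=
  ((h.integrable j).indicator (measurableSet_lt (h.sum_counts_mono hρ).measurable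
    (measurable_const (a := n)))).congr (.of_forall fun s => by
      simp only [indicator_apply, mem_ofPred_eq])

theorem stopped_nonneg (hρ : IsRateFamily ρ K) (n : ℕ) (j : Fin k) (s : ℝ) :
    0 ≤ if ∑ i, counts y (τ s) i < n then ρ j (counts y (τ s)) s else 0 := by
  split_ifs
  exacts [hρ.nonneg j _ s, le_rfl]

theorem stoppedClock_mono (h : IsClockSolution ρ y τ) (hρ : IsRateFamily ρ K) (n : ℕ) :
    Monotone (stoppedClock ρ y τ n) := fun _ _ hst j =>
  setIntegral_Ioc_mono_right (stopped_nonneg hρ n j)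
    (fun _ => (h.integrable_stopped hρ n j).integrableOn) hst

theorem stoppedClock_le_succ (h : IsClockSolution ρ y τ) (hρ : IsRateFamily ρ K) (n : ℕ) (t : ℝ) :
    stoppedClock ρ y τ n t ≤ stoppedClock ρ y τ (n + 1) t := fun j => by
  refine integral_mono (h.integrable_stopped hρ n j).integrableOn
    (h.integrable_stopped hρ (n + 1) j).integrableOn fun s => ?_
  dsimp only
  split_ifs
  exacts [le_rfl, by omega, hρ.nonneg j _ s, le_rfl]

theorem stoppedClock_eq (h : IsClockSolution ρ y τ) {n : ℕ} {t : ℝ}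
    (ht : ∀ s < t, ∑ i, counts y (τ s) i < n) : stoppedClock ρ y τ n t = τ t := by
  ext j
  rw [h.apply_eq, stoppedClock, integral_Ioc_eq_integral_Ioo, integral_Ioc_eq_integral_Ioo]
  refine setIntegral_congr_fun measurableSet_Ioo fun s hs => ?_
  simp only [ht s hs.2, if_true]

theorem stoppedClock_eq_of_le (h : IsClockSolution ρ y τ) (hρ : IsRateFamily ρ K) {n : ℕ}
    {t r : ℝ} (htr : t ≤ r) (ht : n ≤ ∑ i, counts y (τ t) i) :
    stoppedClock ρ y τ n r = stoppedClock ρ y τ n t := by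
  ext j
  refine (setIntegral_eq_of_subset_of_ae_sdiff_eq_zero measurableSet_Ioc.nullMeasurableSet
    (Ioc_subset_Ioc_right htr) (.of_forall fun s hs => ?_))
  rw [if_neg]
  rw [not_lt]
  refine ht.trans (h.sum_counts_mono hρ ?_)
  by_contra! hst
  exact hs.2 ⟨hs.1.1, hst.le⟩

/-- If the total has reached `n` but not `n + 1`, no coordinate has moved since `n` was hit: ordered
vectors with equal totals are equal. -/
theorem counts_stoppedClock (h : IsClockSolution ρ y τ) (hρ : IsRateFamily ρ K) {n : ℕ}
    {r : ℝ} (hr : ∑ i, counts y (τ r) i < n + 1) :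
    counts y (stoppedClock ρ y τ n r) = counts y (τ r) := by
  have key : ∀ t ≤ r, n ≤ ∑ i, counts y (τ t) i → counts y (τ t) = counts y (τ r) := by
    intro t htr hn
    have hle := h.counts_mono hρ htr
    have := (Finset.sum_eq_sum_iff_of_le (s := Finset.univ) fun i _ => hle i).1
      (le_antisymm (Finset.sum_le_sum fun i _ => hle i) (by dsimp only; omega))
    exact funext fun i => this i (Finset.mem_univ i)
  rcases lt_or_ge (∑ i, counts y (τ r) i) n with hlt | hge
  · rw [h.stoppedClock_eq fun s hs => (h.sum_counts_mono hρ hs.le).trans_lt hlt]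
  -- For `n = 0` there is no first hitting time; the stopped clocks vanish, as does the solution at
  -- nonpositive times.
  · rcases Nat.eq_zero_or_pos n with rfl | hn
    · rw [← key (min r 0) (min_le_left _ _) (Nat.zero_le _), h.nonpos (min_le_right _ _)]
      congr 1
      ext j
      simp [stoppedClock]
    · obtain ⟨t, htr, htn, hts⟩ := h.exists_hitting hρ hn hge
      rw [h.stoppedClock_eq_of_le hρ htr htn, h.stoppedClock_eq hts]
      exact key t htr htn

/-- The frozen Picard approximation driven by paths `θ` that agree with `y` up to the time `a` in
the `i`-th coordinate, and everywhere in the others, is the stopped solution driven by `y` as long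
as the `i`-th clock has not passed `a`. -/
theorem frozenClock_eq_stoppedClock (h : IsClockSolution ρ y τ) (hρ : IsRateFamily ρ K)
    {θ : Fin k → ℝ≥0 → ℕ} (hθ : ∀ j, IsCountingPath (θ j)) (i : Fin k) (a : ℝ≥0)
    (hθy : ∀ v : Fin k → ℝ, (v i).toNNReal ≤ a → counts θ v = counts y v) (n : ℕ) :
    ∀ t, (stoppedClock ρ y τ n t i).toNNReal ≤ a →
      frozenClock ρ θ n t = stoppedClock ρ y τ n t := by
  induction n with
  | zero =>
    intro t _
    ext j
    simp [frozenClock, stoppedClock]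
  | succ n ih =>
    intro t ht
    have hle1 : ∀ r ≤ t, (stoppedClock ρ y τ (n + 1) r i).toNNReal ≤ a := fun r hr =>
      (Real.toNNReal_le_toNNReal (h.stoppedClock_mono hρ (n + 1) hr i)).trans ht
    have hle : ∀ r ≤ t, (stoppedClock ρ y τ n r i).toNNReal ≤ a := fun r hr =>
      (Real.toNNReal_le_toNNReal (h.stoppedClock_le_succ hρ n r i)).trans (hle1 r hr)
    have hcounts : ∀ r ≤ t, ∑ j, counts y (τ r) j < n + 1 →
        counts θ (frozenClock ρ θ n r) = counts y (τ r) := by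
      intro r hr hA
      rw [ih r (hle r hr), hθy _ (hle r hr), h.counts_stoppedClock hρ hA]
    -- The integral up to `r` sees only the counts before `r`, so the running clocks are exact at
    -- `r` even if the total reaches `n + 1` there.
    have hrun : ∀ r ≤ t, (∀ s < r, ∑ j, counts y (τ s) j < n + 1) →
        counts θ (runClock ρ θ (frozenClock ρ θ n) r) = counts y (τ r) := by
      intro r hr hA
      have e : runClock ρ θ (frozenClock ρ θ n) r = τ r := by
        ext j
        rw [h.apply_eq, runClock, integral_Ioc_eq_integral_Ioo, integral_Ioc_eq_integral_Ioo]
        refine setIntegral_congr_fun measurableSet_Ioo fun s hs => ?_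
        simp only [hcounts s (hs.2.le.trans hr) (hA s hs.2)]
      rw [e]
      refine hθy _ ?_
      rw [← h.stoppedClock_eq hA]
      exact hle1 r hr
    ext j
    refine setIntegral_congr_fun measurableSet_Ioc fun r hr => ?_
    rcases lt_or_ge (∑ j, counts y (τ r) j) (n + 1) with hA | hA
    · rw [hrun r hr.2 fun s hs => (h.sum_counts_mono hρ hs.le).trans_lt hA, if_pos hA, if_pos hA,
        hcounts r hr.2 hA]
    · rw [if_neg (not_lt.2 hA), if_neg]
      -- The clock driven by `θ` is frozen as well: its running counts are exact at the hitting time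
      -- `t'` and monotone afterwards.
      obtain ⟨t', ht'r, ht'n, ht's⟩ := h.exists_hitting hρ n.succ_pos hA
      rw [not_lt]
      refine ht'n.trans ?_
      rw [← hrun t' (ht'r.trans hr.2) ht's]
      exact Finset.sum_le_sum fun j _ => _root_.counts_mono hθ
        (runClock_mono hρ hθ (frozenClock_mono hρ hθ n) ht'r) j

theorem frozenClock_eq (h : IsClockSolution ρ y τ) (hρ : IsRateFamily ρ K) (n : ℕ) (t : ℝ) :
    frozenClock ρ y n t = stoppedClock ρ y τ n t := by
  ext i
  rw [h.frozenClock_eq_stoppedClock hρ h.path i _ (fun _ _ => rfl) n t le_rfl]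

/-- Whether the stopped `i`-th clock has reached `a` can be read off the paths with the `i`-th one
stopped at `a`. -/
theorem le_frozenClock_stopPath_iff (h : IsClockSolution ρ y τ) (hρ : IsRateFamily ρ K)
    (i : Fin k) (a : ℝ≥0) (n : ℕ) (t : ℝ) :
    a ≤ (frozenClock ρ (stopPath i a y) n t i).toNNReal ↔
      a ≤ (frozenClock ρ y n t i).toNNReal := by
  have hθ : ∀ j, IsCountingPath (stopPath i a y j) := by
    intro j
    by_cases hj : j = i
    · have : stopPath i a y j = fun s => y j (min s a) := by ext s; simp [stopPath, hj]
      rw [this]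
      exact (h.path j).stopped a
    · have : stopPath i a y j = y j := by ext s; simp [stopPath, hj]
      rw [this]
      exact h.path j
  have hθy : ∀ v : Fin k → ℝ, (v i).toNNReal ≤ a → counts (stopPath i a y) v = counts y v := by
    intro v hv
    ext j
    rw [counts_eq hθ, counts_eq h.path]
    by_cases hj : j = i
    · subst hj
      simp [stopPath, hv]
    · simp [stopPath, hj]
  have key := h.frozenClock_eq_stoppedClock hρ hθ i a hθy n
  rw [h.frozenClock_eq hρ]
  constructor
  · intro ha
    by_contra! hlt
    rw [key t hlt.le] at ha
    exact absurd ha (not_le.2 hlt)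
  · intro ha
    -- By continuity the true stopped clock equals `a` at some `t₀ ≤ t`, where the two clocks still
    -- agree; monotonicity carries the bound to `t`. The time `min t 0` serves as a start at which
    -- the clock is `0`.
    have hc : Continuous fun t => (stoppedClock ρ y τ n t i).toNNReal :=
      continuous_real_toNNReal.comp (continuous_stoppedIntegral (h.integrable_stopped hρ n i))
    have h0 : (stoppedClock ρ y τ n (min t 0) i).toNNReal = 0 := by
      simp [stoppedClock]
    obtain ⟨t₀, ht₀, he⟩ := intermediate_value_Icc (min_le_left t 0) hc.continuousOn
      (show a ∈ Icc _ _ from ⟨by rw [h0]; exact zero_le, ha⟩)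
    have h1 := key t₀ he.le
    calc a = (frozenClock ρ (stopPath i a y) n t₀ i).toNNReal := by rw [h1]; exact he.symm
      _ ≤ _ := Real.toNNReal_le_toNNReal (frozenClock_mono hρ hθ n ht₀.2 i)

end IsClockSolution

theorem frozenClock_zero (y : Fin k → ℝ≥0 → ℕ) (t : ℝ) : frozenClock ρ y 0 t = 0 := rfl

theorem frozenClock_succ (y : Fin k → ℝ≥0 → ℕ) (n : ℕ) (t : ℝ) (j : Fin k) :
    frozenClock ρ y (n + 1) t j = ∫ s in Ioc 0 t,
      if ∑ i, counts y (runClock ρ y (frozenClock ρ y n) s) i < n + 1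
      then ρ j (counts y (frozenClock ρ y n s)) s else 0 := rfl

attribute [irreducible] frozenClock counts

end

/-! ### First moments of counts and clocks -/

section

variable {k : ℕ} {ρ : Fin k → (Fin k → ℕ) → ℝ → ℝ} {K : ℝ}

/-- The clocks of the counting process driven by `y`, as the limit of their frozen
approximations. -/
noncomputable def limClock (ρ : Fin k → (Fin k → ℕ) → ℝ → ℝ) (y : Fin k → ℝ≥0 → ℕ) (t : ℝ) :
    Fin k → ℝ := fun j => liminf (fun n => frozenClock ρ y n t j) atTop

theorem measurable_limClock (hρ : IsRateFamily ρ K) (j : Fin k) :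
    Measurable fun z : (Fin k → ℝ≥0 → ℕ) × ℝ => limClock ρ z.1 z.2 j :=
  Measurable.liminf fun n => measurable_frozenClock hρ n j

namespace IsClockSolution

variable {y : Fin k → ℝ≥0 → ℕ} {τ : ℝ → Fin k → ℝ}

/-- The total count at `t` is finite, so a stage beyond it has not frozen by `t`. -/
theorem eventually_frozenClock_eq (h : IsClockSolution ρ y τ) (hρ : IsRateFamily ρ K) (t : ℝ) :
    ∀ᶠ n in atTop, frozenClock ρ y n t = τ t := by
  filter_upwards [eventually_gt_atTop (∑ i, counts y (τ t) i)] with n hn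
  rw [h.frozenClock_eq hρ, h.stoppedClock_eq fun s hs => (h.sum_counts_mono hρ hs.le).trans_lt hn]

theorem limClock_eq (h : IsClockSolution ρ y τ) (hρ : IsRateFamily ρ K) (t : ℝ) :
    limClock ρ y t = τ t := by
  ext j
  refine Tendsto.liminf_eq (tendsto_const_nhds.congr' ?_)
  filter_upwards [h.eventually_frozenClock_eq hρ t] with n hn
  rw [hn]

theorem frozenClock_monotone (h : IsClockSolution ρ y τ) (hρ : IsRateFamily ρ K) (t : ℝ) :
    Monotone fun n => frozenClock ρ y n t :=
  monotone_nat_of_le_succ fun n => by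
    rw [h.frozenClock_eq hρ, h.frozenClock_eq hρ]
    exact h.stoppedClock_le_succ hρ n t

end IsClockSolution

/-- No integrability is required, since the Bochner integral defaults to `0`; hence the next bound
holds for arbitrary `y`. -/
theorem ofReal_integral_le_lintegral {α : Type*} [MeasurableSpace α] {μ : Measure α} {g : α → ℝ}
    (hg : Measurable g) (h0 : ∀ x, 0 ≤ g x) :
    ENNReal.ofReal (∫ x, g x ∂μ) ≤ ∫⁻ x, ENNReal.ofReal (g x) ∂μ := by
  rw [integral_eq_lintegral_of_nonneg_ae (.of_forall h0) hg.aestronglyMeasurable]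
  exact ENNReal.ofReal_toReal_le

theorem ofReal_frozenClock_succ_le (hρ : IsRateFamily ρ K) (hK : 0 ≤ K) (y : Fin k → ℝ≥0 → ℕ)
    (n : ℕ) (t : ℝ) (j : Fin k) :
    ENNReal.ofReal (frozenClock ρ y (n + 1) t j) ≤
      ∫⁻ s in Ioc 0 t, ENNReal.ofReal K *
        (1 + ∑ i, (counts y (frozenClock ρ y n s) i : ENNReal)) := by
  have hu : ∀ j, Measurable fun s => frozenClock ρ y n s j := fun j =>
    (measurable_frozenClock hρ n j).comp measurable_prodMk_left
  have hw : ∀ j, Measurable fun s => runClock ρ y (frozenClock ρ y n) s j := fun j =>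
    (measurable_runClock (u := fun y => frozenClock ρ y n) hρ
      (measurable_frozenClock hρ n) j).comp measurable_prodMk_left
  rw [frozenClock_succ]
  refine (ofReal_integral_le_lintegral ?_ fun s => ?_).trans (lintegral_mono fun s => ?_)
  · refine Measurable.ite (measurableSet_lt (Finset.measurable_sum _ fun i _ =>
      (measurable_pi_apply i).comp (measurable_counts measurable_const hw)) measurable_const)
      (hρ.measurable_comp j (measurable_counts measurable_const hu) measurable_id) measurable_const
  · split_ifs
    exacts [hρ.nonneg j _ s, le_rfl]
  · have h1 : (if ∑ i, counts y (runClock ρ y (frozenClock ρ y n) s) i < n + 1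
        then ρ j (counts y (frozenClock ρ y n s)) s else 0) ≤
        K * (1 + ∑ i, (counts y (frozenClock ρ y n s) i : ℝ)) := by
      split_ifs
      · exact hρ.le j _ s
      · positivity
    refine (ENNReal.ofReal_le_ofReal h1).trans (le_of_eq ?_)
    rw [ENNReal.ofReal_mul hK, ENNReal.ofReal_add zero_le_one (by positivity), ENNReal.ofReal_one,
      ENNReal.ofReal_sum_of_nonneg fun i _ => by positivity]
    simp

attribute [irreducible] limClock

theorem lintegral_Ioc_mul_exp {b t : ℝ} (hb : 0 ≤ b) (ht : 0 ≤ t) :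
    ∫⁻ s in Ioc 0 t, ENNReal.ofReal (b * Real.exp (b * s)) =
      ENNReal.ofReal (Real.exp (b * t) - 1) := by
  have hc : Continuous fun s => b * Real.exp (b * s) := by fun_prop
  rw [← ofReal_integral_eq_lintegral_ofReal (hc.integrableOn_Ioc)
    (.of_forall fun s => by positivity), ← intervalIntegral.integral_of_le ht,
    intervalIntegral.integral_eq_sub_of_hasDerivAt (f := fun s => Real.exp (b * s))
      (fun s _ => ?_) (hc.intervalIntegrable 0 t)]
  · simp
  · have h1 : HasDerivAt (fun t : ℝ => b * t) b s := by simpa using (hasDerivAt_id s).const_mul b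
    exact h1.exp.congr_deriv (mul_comm _ _)

variable {Ω : Type*} [MeasurableSpace Ω] {P : Measure Ω} {Y : Fin k → ℝ≥0 → Ω → ℕ}

/-- The driving paths at a sample point. -/
def samplePath (Y : Fin k → ℝ≥0 → Ω → ℕ) (ω : Ω) : Fin k → ℝ≥0 → ℕ := fun j s => Y j s ω

theorem IsIndepUnitPoissonFamily.measurable_samplePath (hY : IsIndepUnitPoissonFamily P Y) :
    Measurable (samplePath Y) :=
  measurable_pi_lambda _ fun j => measurable_pi_lambda _ fun s => (hY.poisson j).measurable s

theorem measurable_stopPath (i : Fin k) (a : ℝ≥0) :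
    Measurable (stopPath i a : (Fin k → ℝ≥0 → ℕ) → Fin k → ℝ≥0 → ℕ) := by
  refine measurable_pi_lambda _ fun j => measurable_pi_lambda _ fun s => ?_
  by_cases h : j = i
  · simp only [stopPath, h, if_true]; fun_prop
  · simp only [stopPath, h, if_false]; fun_prop

variable {τ : ℝ → Ω → Fin k → ℝ}

/-- Optional stopping for one coordinate. The event is replaced by its version computed from
`stopPath i a`, almost surely the same and independent of the increments after `a`. -/
theorem lintegral_counts_frozenClock [IsProbabilityMeasure P]
    (hY : IsIndepUnitPoissonFamily P Y) (hρ : IsRateFamily ρ K)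
    (hτ : ∀ᵐ ω ∂P, IsClockSolution ρ (samplePath Y ω) fun t => τ t ω) (n : ℕ) (t : ℝ) (i : Fin k)
    (hfin : ∫⁻ ω, ENNReal.ofReal (frozenClock ρ (samplePath Y ω) n t i) ∂P ≠ ⊤) :
    ∫⁻ ω, (counts (samplePath Y ω) (frozenClock ρ (samplePath Y ω) n t) i : ENNReal) ∂P =
      ∫⁻ ω, ENNReal.ofReal (frozenClock ρ (samplePath Y ω) n t i) ∂P := by
  have hm : Measurable fun y => frozenClock ρ y n t i :=
    (measurable_frozenClock hρ n i).comp measurable_prodMk_right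
  refine Eq.trans ?_ ((hY.poisson i).lintegral_stopped
    (v := fun ω => (frozenClock ρ (samplePath Y ω) n t i).toNNReal)
    (hm.comp hY.measurable_samplePath).real_toNNReal.aemeasurable hfin ?_)
  · refine lintegral_congr_ae ?_
    filter_upwards [hτ] with ω h
    rw [counts_eq h.path]
    rfl
  · intro a b hab
    have hS : MeasurableSet {y : Fin k → ℝ≥0 → ℕ | a ≤ (frozenClock ρ y n t i).toNNReal} :=
      measurableSet_le measurable_const hm.real_toNNReal
    refine ⟨{ω | a ≤ (frozenClock ρ (stopPath i a (samplePath Y ω)) n t i).toNNReal},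
      ((measurable_stopPath i a).comp hY.measurable_samplePath) hS, ?_, ?_⟩
    · refine eventuallyEq_set.2 ?_
      filter_upwards [hτ] with ω h using h.le_frozenClock_stopPath_iff hρ i a n t
    · exact (hY.indepFun_stopPath_increment i hab).comp
        (φ := {y : Fin k → ℝ≥0 → ℕ | a ≤ (frozenClock ρ y n t i).toNNReal}.indicator
          (1 : (Fin k → ℝ≥0 → ℕ) → ENNReal)) (ψ := id) (measurable_one.indicator hS) measurable_id

/-- Grönwall along the induction on `n`: linear growth bounds each mean clock by the integral of `K
* exp (k * K * s)` from the previous stage, and the sum over `k` coordinates is `exp (k * K * t) -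
1`. The finiteness so obtained permits optional stopping, which turns mean clocks into mean counts.
-/
theorem lintegral_frozenClock_bounds [IsProbabilityMeasure P]
    (hY : IsIndepUnitPoissonFamily P Y) (hρ : IsRateFamily ρ K) (hK : 0 ≤ K)
    (hτ : ∀ᵐ ω ∂P, IsClockSolution ρ (samplePath Y ω) fun t => τ t ω) (n : ℕ) :
    ∀ t : ℝ, 0 ≤ t →
    (∀ i, ∫⁻ ω, ENNReal.ofReal (frozenClock ρ (samplePath Y ω) n t i) ∂P ≠ ⊤) ∧
    1 + ∑ i, ∫⁻ ω, (counts (samplePath Y ω) (frozenClock ρ (samplePath Y ω) n t) i : ENNReal) ∂P ≤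
      ENNReal.ofReal (Real.exp (k * K * t)) := by
  have hC : ∀ n i, Measurable fun z : Ω × ℝ => frozenClock ρ (samplePath Y z.1) n z.2 i :=
    fun n i => (measurable_frozenClock hρ n i).comp
      ((hY.measurable_samplePath.comp measurable_fst).prodMk measurable_snd)
  have hcast : Measurable fun n : ℕ => (n : ENNReal) := .of_discrete
  have hN : ∀ n i, Measurable fun z : Ω × ℝ =>
      (counts (samplePath Y z.1) (frozenClock ρ (samplePath Y z.1) n z.2) i : ENNReal) :=
    fun n i => hcast.comp ((measurable_pi_apply i).comp
      (measurable_counts (hY.measurable_samplePath.comp measurable_fst) (hC n)))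
  induction n with
  | zero =>
    intro t ht
    have h0 : ∀ᵐ ω ∂P, ∀ i, counts (samplePath Y ω) (frozenClock ρ (samplePath Y ω) 0 t) i = 0 := by
      filter_upwards [hτ] with ω h i
      rw [counts_eq h.path]
      simp [frozenClock_zero, (h.path i).zero]
    refine ⟨fun i => by simp [frozenClock_zero], ?_⟩
    have h1 : ∀ i, ∫⁻ ω, (counts (samplePath Y ω) (frozenClock ρ (samplePath Y ω) 0 t) i : ENNReal) ∂P = 0 := by
      intro i
      refine (lintegral_congr_ae ?_).trans lintegral_zero
      filter_upwards [h0] with ω h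
      simp [h i]
    simp only [h1, Finset.sum_const_zero, add_zero]
    rw [ENNReal.one_le_ofReal, Real.one_le_exp_iff]
    positivity
  | succ n ih =>
    intro t ht
    have hb : ∀ i, ∫⁻ ω, ENNReal.ofReal (frozenClock ρ (samplePath Y ω) (n + 1) t i) ∂P ≤
        ∫⁻ s in Ioc 0 t, ENNReal.ofReal (K * Real.exp (k * K * s)) := by
      intro i
      refine (lintegral_mono fun ω => ofReal_frozenClock_succ_le hρ hK _ n t i).trans ?_
      rw [lintegral_lintegral_swap]
      · refine setLIntegral_mono' measurableSet_Ioc fun s hs => ?_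
        have hNs : ∀ i, Measurable fun ω => (counts (samplePath Y ω)
            (frozenClock ρ (samplePath Y ω) n s) i : ENNReal) := fun i =>
          (hN n i).comp (measurable_id.prodMk (measurable_const (a := s)))
        rw [lintegral_const_mul' _ _ ENNReal.ofReal_ne_top, ENNReal.ofReal_mul hK,
          lintegral_add_left measurable_const, lintegral_finsetSum _ fun i _ => hNs i]
        gcongr
        simpa using (ih s hs.1.le).2
      · refine Measurable.aemeasurable ?_
        have hNsum : Measurable fun z : Ω × ℝ => ∑ i, (counts (samplePath Y z.1)
            (frozenClock ρ (samplePath Y z.1) n z.2) i : ENNReal) :=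
          Finset.measurable_sum _ fun i _ => hN n i
        exact (measurable_const.add hNsum).const_mul _
    have hfin : ∀ i, ∫⁻ ω, ENNReal.ofReal (frozenClock ρ (samplePath Y ω) (n + 1) t i) ∂P ≠ ⊤ := by
      intro i
      refine ne_top_of_le_ne_top ?_ (hb i)
      have hc : Continuous fun s => K * Real.exp (k * K * s) := by fun_prop
      exact (hc.integrableOn_Ioc (a := 0) (b := t)).lintegral_lt_top.ne
    refine ⟨hfin, ?_⟩
    simp only [fun i => lintegral_counts_frozenClock hY hρ hτ (n + 1) t i (hfin i)]
    have hsum : ∑ i, ∫⁻ ω, ENNReal.ofReal (frozenClock ρ (samplePath Y ω) (n + 1) t i) ∂P ≤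
        ENNReal.ofReal (Real.exp (k * K * t) - 1) := by
      refine (Finset.sum_le_sum fun i _ => hb i).trans (le_of_eq ?_)
      rw [Finset.sum_const, Finset.card_univ, Fintype.card_fin, nsmul_eq_mul,
        ← lintegral_const_mul' _ _ (by simp), ← lintegral_Ioc_mul_exp (by positivity) ht]
      refine lintegral_congr fun s => ?_
      rw [← ENNReal.ofReal_natCast, ← ENNReal.ofReal_mul (by positivity), ← mul_assoc]
    refine (add_le_add_right hsum 1).trans ?_
    rw [← ENNReal.ofReal_one, ← ENNReal.ofReal_add zero_le_one]
    · simp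
    · rw [sub_nonneg, Real.one_le_exp_iff]
      positivity

/-- The mean of the counts of a counting process is bounded, and equals the mean of its clocks. -/
theorem lintegral_counts_eq [IsProbabilityMeasure P]
    (hY : IsIndepUnitPoissonFamily P Y) (hρ : IsRateFamily ρ K) (hK : 0 ≤ K)
    (hτ : ∀ᵐ ω ∂P, IsClockSolution ρ (samplePath Y ω) fun t => τ t ω) {t : ℝ} (ht : 0 ≤ t)
    (i : Fin k) :
    ∫⁻ ω, (counts (samplePath Y ω) (τ t ω) i : ENNReal) ∂P = ∫⁻ ω, ENNReal.ofReal (τ t ω i) ∂P ∧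
    ∫⁻ ω, (counts (samplePath Y ω) (τ t ω) i : ENNReal) ∂P ≤
      ENNReal.ofReal (Real.exp (k * K * t)) := by
  have hb := fun n => lintegral_frozenClock_bounds hY hρ hK hτ n t ht
  have hC : ∀ n i, Measurable fun ω => frozenClock ρ (samplePath Y ω) n t i :=
    fun n i => (measurable_frozenClock hρ n i).comp
      (hY.measurable_samplePath.prodMk measurable_const)
  have hcast : Measurable fun n : ℕ => (n : ENNReal) := .of_discrete
  have l1 : Tendsto (fun n => ∫⁻ ω, (counts (samplePath Y ω)
      (frozenClock ρ (samplePath Y ω) n t) i : ENNReal) ∂P) atTop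
      (𝓝 (∫⁻ ω, (counts (samplePath Y ω) (τ t ω) i : ENNReal) ∂P)) := by
    refine lintegral_tendsto_of_tendsto_of_monotone (fun n => ?_) ?_ ?_
    · exact (hcast.comp ((measurable_pi_apply i).comp
        (measurable_counts hY.measurable_samplePath (hC n)))).aemeasurable
    · filter_upwards [hτ] with ω h n m hnm
      exact Nat.cast_le.2 (counts_mono h.path (h.frozenClock_monotone hρ t hnm) i)
    · filter_upwards [hτ] with ω h
      refine tendsto_const_nhds.congr' ?_
      filter_upwards [h.eventually_frozenClock_eq hρ t] with n hn
      rw [hn]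
  have l2 : Tendsto (fun n => ∫⁻ ω, ENNReal.ofReal (frozenClock ρ (samplePath Y ω) n t i) ∂P) atTop
      (𝓝 (∫⁻ ω, ENNReal.ofReal (τ t ω i) ∂P)) := by
    refine lintegral_tendsto_of_tendsto_of_monotone (fun n => ?_) ?_ ?_
    · exact (hC n i).ennreal_ofReal.aemeasurable
    · filter_upwards [hτ] with ω h n m hnm
      exact ENNReal.ofReal_le_ofReal (h.frozenClock_monotone hρ t hnm i)
    · filter_upwards [hτ] with ω h
      refine tendsto_const_nhds.congr' ?_
      filter_upwards [h.eventually_frozenClock_eq hρ t] with n hn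
      rw [hn]
  refine ⟨tendsto_nhds_unique l1 (l2.congr fun n => ?_), le_of_tendsto' l1 fun n => ?_⟩
  · rw [lintegral_counts_frozenClock hY hρ hτ n t i ((hb n).1 i)]
  · exact (Finset.single_le_sum (f := fun i => ∫⁻ ω, (counts (samplePath Y ω)
      (frozenClock ρ (samplePath Y ω) n t) i : ENNReal) ∂P) (fun _ _ => zero_le)
      (Finset.mem_univ i)).trans (le_add_self.trans (hb n).2)

/-- The mean of the counts of a counting process is the integral of its mean rate. -/
theorem integral_counts_eq [IsProbabilityMeasure P]
    (hY : IsIndepUnitPoissonFamily P Y) (hρ : IsRateFamily ρ K) (hK : 0 ≤ K)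
    (hτ : ∀ᵐ ω ∂P, IsClockSolution ρ (samplePath Y ω) fun t => τ t ω) {t : ℝ} (ht : 0 ≤ t)
    (i : Fin k) :
    Integrable (fun ω => (counts (samplePath Y ω) (τ t ω) i : ℝ)) P ∧
    ∫ ω, (counts (samplePath Y ω) (τ t ω) i : ℝ) ∂P ≤ Real.exp (k * K * t) ∧
    IntegrableOn (fun s => ∫ ω, ρ i (counts (samplePath Y ω) (τ s ω)) s ∂P) (Ioc 0 t) ∧
    ∫ ω, (counts (samplePath Y ω) (τ t ω) i : ℝ) ∂P =
      ∫ s in Ioc 0 t, ∫ ω, ρ i (counts (samplePath Y ω) (τ s ω)) s ∂P := by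
  obtain ⟨heq, hle⟩ := lintegral_counts_eq hY hρ hK hτ ht i
  have hcastR : Measurable fun n : ℕ => (n : ℝ) := .of_discrete
  have hlim : ∀ j, Measurable fun z : ℝ × Ω => limClock ρ (samplePath Y z.2) z.1 j := fun j =>
    (measurable_limClock hρ j).comp
      ((hY.measurable_samplePath.comp measurable_snd).prodMk measurable_fst)
  have hcounts : Measurable fun z : ℝ × Ω =>
      counts (samplePath Y z.2) (limClock ρ (samplePath Y z.2) z.1) :=
    measurable_counts (hY.measurable_samplePath.comp measurable_snd) hlim
  have hcm : AEStronglyMeasurable (fun ω => (counts (samplePath Y ω) (τ t ω) i : ℝ)) P := by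
    refine AEStronglyMeasurable.congr (f := fun ω =>
      (counts (samplePath Y ω) (limClock ρ (samplePath Y ω) t) i : ℝ)) ?_ ?_
    · have hct : Measurable fun ω => counts (samplePath Y ω) (limClock ρ (samplePath Y ω) t) :=
        measurable_counts hY.measurable_samplePath fun j =>
          (measurable_limClock hρ j).comp (hY.measurable_samplePath.prodMk measurable_const)
      exact (hcastR.comp ((measurable_pi_apply i).comp hct)).aestronglyMeasurable
    · filter_upwards [hτ] with ω h
      rw [h.limClock_eq hρ]
  have hcint : ∫ ω, (counts (samplePath Y ω) (τ t ω) i : ℝ) ∂P =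
      (∫⁻ ω, (counts (samplePath Y ω) (τ t ω) i : ENNReal) ∂P).toReal := by
    rw [integral_eq_lintegral_of_nonneg_ae (.of_forall fun ω => by positivity) hcm]
    simp
  -- `τ` is not known to be jointly measurable in time and `ω`; `limClock` is a jointly measurable
  -- version, to which Fubini applies.
  set J : ℝ × Ω → ℝ := fun z =>
    ρ i (counts (samplePath Y z.2) (limClock ρ (samplePath Y z.2) z.1)) z.1
  have hJm : Measurable J := hρ.measurable_comp i hcounts measurable_fst
  have hJ : ∀ s, ∫ ω, J (s, ω) ∂P = ∫ ω, ρ i (counts (samplePath Y ω) (τ s ω)) s ∂P := by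
    intro s
    refine integral_congr_ae ?_
    filter_upwards [hτ] with ω h
    simp only [J, h.limClock_eq hρ]
  have hJl : ∫⁻ z, ENNReal.ofReal (J z) ∂((volume.restrict (Ioc 0 t)).prod P) =
      ∫⁻ ω, (counts (samplePath Y ω) (τ t ω) i : ENNReal) ∂P := by
    rw [heq, lintegral_prod _ hJm.ennreal_ofReal.aemeasurable,
      lintegral_lintegral_swap hJm.ennreal_ofReal.aemeasurable]
    refine lintegral_congr_ae ?_
    filter_upwards [hτ] with ω h
    rw [h.apply_eq, ofReal_integral_eq_lintegral_ofReal (h.integrable i).integrableOn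
      (.of_forall fun s => hρ.nonneg i _ s)]
    simp only [J, h.limClock_eq hρ]
  have hJi : Integrable J ((volume.restrict (Ioc 0 t)).prod P) := by
    refine ⟨hJm.aestronglyMeasurable, ?_⟩
    rw [hasFiniteIntegral_iff_ofReal (.of_forall fun z => hρ.nonneg i _ _), hJl]
    exact hle.trans_lt ENNReal.ofReal_lt_top
  refine ⟨⟨hcm, ?_⟩, ?_, ?_, ?_⟩
  · rw [hasFiniteIntegral_iff_ofReal (.of_forall fun ω => by positivity)]
    simpa using hle.trans_lt ENNReal.ofReal_lt_top
  · rw [hcint]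
    exact ENNReal.toReal_le_of_le_ofReal (Real.exp_nonneg _) hle
  · simpa only [IntegrableOn, hJ] using hJi.integral_prod_left
  · rw [hcint, ← hJl, ← integral_eq_lintegral_of_nonneg_ae (.of_forall fun z => hρ.nonneg i _ _)
      hJm.aestronglyMeasurable, integral_prod _ hJi]
    simp only [hJ]

end

/-! ### The fluid equation and pathwise convergence -/

section

variable {d k : ℕ} {T D M : ℝ} {x₀ : EuclideanSpace ℝ (Fin d)}
  {v : Fin k → EuclideanSpace ℝ (Fin d)} {g : Fin k → ℝ → EuclideanSpace ℝ (Fin d) → ℝ}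
  {z w : ℝ → EuclideanSpace ℝ (Fin d)}

/-- Only the summed drift is Lipschitz, not each rate, so the integrals are merged before
estimating. -/
theorem norm_sum_integral_smul_sub_le
    (hg : ∀ t ∈ Icc 0 T, ∀ x y, ‖(∑ i, g i t x • v i) - ∑ i, g i t y • v i‖ ≤ M * ‖x - y‖)
    (hw : ∀ i, IntegrableOn (fun s => g i s (w s)) (Icc 0 T))
    (hz : ∀ i, IntegrableOn (fun s => g i s (z s)) (Icc 0 T))
    (hwz : IntegrableOn (fun s => ‖w s - z s‖) (Icc 0 T)) {t : ℝ} (ht : t ∈ Icc 0 T) :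
    ‖(∑ i, (∫ s in (0 : ℝ)..t, g i s (w s)) • v i) - ∑ i, (∫ s in (0 : ℝ)..t, g i s (z s)) • v i‖ ≤
      M * ∫ s in (0 : ℝ)..t, ‖w s - z s‖ := by
  have hI : ∀ {h : ℝ → ℝ}, IntegrableOn h (Icc 0 T) → IntervalIntegrable h volume 0 t := fun h =>
    (intervalIntegrable_iff_integrableOn_Icc_of_le ht.1).2 (h.mono_set (Icc_subset_Icc_right ht.2))
  have hsmul : ∀ {h : ℝ → ℝ} (e : EuclideanSpace ℝ (Fin d)), IntervalIntegrable h volume 0 t →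
      IntervalIntegrable (fun s => h s • e) volume 0 t := fun e h =>
    ⟨h.1.smul_const e, h.2.smul_const e⟩
  have e : (∑ i, (∫ s in (0 : ℝ)..t, g i s (w s)) • v i) -
      ∑ i, (∫ s in (0 : ℝ)..t, g i s (z s)) • v i =
      ∫ s in (0 : ℝ)..t, ((∑ i, g i s (w s) • v i) - ∑ i, g i s (z s) • v i) := by
    rw [intervalIntegral.integral_sub, intervalIntegral.integral_finsetSum,
      intervalIntegral.integral_finsetSum]
    · simp only [intervalIntegral.integral_smul_const]
    · exact fun i _ => hsmul _ (hI (hz i))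
    · exact fun i _ => hsmul _ (hI (hw i))
    · simpa only [Finset.sum_fn] using IntervalIntegrable.sum Finset.univ
        fun i _ => hsmul (v i) (hI (hw i))
    · simpa only [Finset.sum_fn] using IntervalIntegrable.sum Finset.univ
        fun i _ => hsmul (v i) (hI (hz i))
  rw [e, ← intervalIntegral.integral_const_mul]
  refine intervalIntegral.norm_integral_le_of_norm_le ht.1 (.of_forall fun s hs => ?_)
    ((hI hwz).const_mul M)
  exact hg s ⟨hs.1.le, hs.2.trans ht.2⟩ _ _

theorem IsFluidSolution.continuousOn (hT : 0 ≤ T) (hz : IsFluidSolution T x₀ v g z) :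
    ContinuousOn z (Icc 0 T) := by
  refine ContinuousOn.congr (f := fun t => x₀ + ∑ i, (∫ s in (0 : ℝ)..t, g i s (z s)) • v i) ?_
    hz.equation
  refine continuousOn_const.add (continuousOn_finsetSum _ fun i _ => ?_)
  refine ContinuousOn.fun_smul ?_ continuousOn_const
  have := intervalIntegral.continuousOn_primitive_interval (μ := volume) (a := 0) (b := T)
    (f := fun s => g i s (z s)) (by rw [uIcc_of_le hT]; exact hz.integrable i)
  rwa [uIcc_of_le hT] at this

theorem IsFluidSolution.unique (hT : 0 ≤ T) (hM : 0 ≤ M)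
    (hg : ∀ t ∈ Icc 0 T, ∀ x y, ‖(∑ i, g i t x • v i) - ∑ i, g i t y • v i‖ ≤ M * ‖x - y‖)
    (hw : IsFluidSolution T x₀ v g w) (hz : IsFluidSolution T x₀ v g z) :
    ∀ t ∈ Icc 0 T, w t = z t := by
  have hcont : ContinuousOn (fun s => ‖w s - z s‖) (Icc 0 T) :=
    ((hw.continuousOn hT).sub (hz.continuousOn hT)).norm
  obtain ⟨S, hS⟩ := isCompact_Icc.bddAbove_image hcont
  have hint := hcont.integrableOn_compact (μ := volume) isCompact_Icc
  intro t ht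
  have := le_mul_exp_of_le_add_integral (a := 0) le_rfl hM hint
    (fun t ht => hS (mem_image_of_mem _ ht)) (fun t ht => ?_) t ht
  · rw [zero_mul] at this
    exact sub_eq_zero.1 (norm_le_zero_iff.1 this)
  · rw [zero_add, hw.equation t ht, hz.equation t ht, add_sub_add_left_eq_sub]
    exact norm_sum_integral_smul_sub_le hg hw.integrable hz.integrable hint ht

/-- Paths of the rescaled time-change equations converge to the fluid limit, when the driving
paths satisfy the law of large numbers. -/
theorem tendstoUniformlyOn_fluid (hT : 0 ≤ T) (hM : 0 ≤ M) (hD : 0 ≤ D)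
    (hg : ∀ t ∈ Icc 0 T, ∀ x y, ‖(∑ i, g i t x • v i) - ∑ i, g i t y • v i‖ ≤ M * ‖x - y‖)
    (hgD : ∀ i, ∀ t ∈ Icc 0 T, ∀ x, g i t x ≤ D * (1 + ‖x‖))
    (hz : IsFluidSolution T x₀ v g z) {y : Fin k → ℝ≥0 → ℕ} (hy : ∀ i, Monotone (y i))
    (hlln : ∀ i, ∀ ε : ℝ, 0 < ε → ∃ C : ℝ, 0 ≤ C ∧ ∀ s : ℝ≥0, |(y i s : ℝ) - s| ≤ ε * s + C)
    {x : ℕ → ℝ → EuclideanSpace ℝ (Fin d)}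
    (hnn : ∀ n : ℕ, 1 ≤ n → ∀ i, ∀ s ∈ Icc 0 T, 0 ≤ (n : ℝ) * g i s (x n s))
    (hint : ∀ n : ℕ, 1 ≤ n → ∀ i, IntegrableOn (fun s => (n : ℝ) * g i s (x n s)) (Icc 0 T))
    (heq : ∀ n : ℕ, 1 ≤ n → ∀ t ∈ Icc 0 T, x n t = x₀ + ∑ i,
      (y i (∫ s in (0 : ℝ)..t, (n : ℝ) * g i s (x n s)).toNNReal : ℝ) • ((1 / (n : ℝ)) • v i)) :
    TendstoUniformlyOn x z atTop (Icc 0 T) := by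
  set L := ∑ i, ‖v i‖
  have hL : 0 ≤ L := Finset.sum_nonneg fun _ _ => norm_nonneg _
  have hlln' : ∀ ε : ℝ, 0 < ε → ∃ C : ℝ, 0 ≤ C ∧ ∀ i, ∀ s : ℝ≥0,
      |(y i s : ℝ) - s| ≤ ε * s + C := by
    intro ε hε
    choose C hC0 hC using fun i => hlln i ε hε
    refine ⟨∑ i, C i, Finset.sum_nonneg fun i _ => hC0 i, fun i s => (hC i s).trans ?_⟩
    gcongr
    exact Finset.single_le_sum (fun i _ => hC0 i) (Finset.mem_univ i)
  have hg0 : ∀ n : ℕ, 1 ≤ n → ∀ i, ∀ s ∈ Icc 0 T, 0 ≤ g i s (x n s) := fun n hn i s hs =>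
    nonneg_of_mul_nonneg_right (hnn n hn i s hs) (by exact_mod_cast hn)
  have hgi : ∀ n : ℕ, 1 ≤ n → ∀ i, IntegrableOn (fun s => g i s (x n s)) (Icc 0 T) := by
    intro n hn i
    have hn' : (n : ℝ) ≠ 0 := by positivity
    refine ((hint n hn i).const_mul (n : ℝ)⁻¹).congr (.of_forall fun s => ?_)
    simp [hn']
  have hI : ∀ {h : ℝ → ℝ}, IntegrableOn h (Icc 0 T) → ∀ t ∈ Icc 0 T,
      IntervalIntegrable h volume 0 t := fun h t ht =>
    (intervalIntegrable_iff_integrableOn_Icc_of_le ht.1).2 (h.mono_set (Icc_subset_Icc_right ht.2))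
  set u : ℕ → Fin k → ℝ → ℝ := fun n i t => ∫ s in (0 : ℝ)..t, g i s (x n s)
  have hu0 : ∀ n : ℕ, 1 ≤ n → ∀ i, ∀ t ∈ Icc 0 T, 0 ≤ u n i t := fun n hn i t ht =>
    intervalIntegral.integral_nonneg ht.1 fun s hs => hg0 n hn i s ⟨hs.1, hs.2.trans ht.2⟩
  have humono : ∀ n : ℕ, 1 ≤ n → ∀ i, MonotoneOn (u n i) (Icc 0 T) := by
    intro n hn i s hs t ht hst
    refine intervalIntegral.integral_mono_interval le_rfl hs.1 hst ?_ (hI (hgi n hn i) t ht)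
    exact (ae_restrict_iff' measurableSet_Ioc).2
      (.of_forall fun r hr => hg0 n hn i r ⟨hr.1.le, hr.2.trans ht.2⟩)
  have heq' : ∀ n : ℕ, 1 ≤ n → ∀ t ∈ Icc 0 T, x n t = x₀ + ∑ i,
      ((y i (n * u n i t).toNNReal : ℝ) / n) • v i := by
    intro n hn t ht
    rw [heq n hn t ht]
    congr 1
    refine Finset.sum_congr rfl fun i _ => ?_
    rw [smul_smul, intervalIntegral.integral_const_mul, mul_one_div]
  have herr : ∀ ε C : ℝ, (∀ i, ∀ s : ℝ≥0, |(y i s : ℝ) - s| ≤ ε * s + C) → ∀ n : ℕ, 1 ≤ n →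
      ∀ t ∈ Icc 0 T, ‖x n t - (x₀ + ∑ i, u n i t • v i)‖ ≤
        ∑ i, (ε * u n i t + C / n) * ‖v i‖ := by
    intro ε C hC n hn t ht
    have hn0 : (0 : ℝ) < n := by exact_mod_cast hn
    rw [heq' n hn t ht, add_sub_add_left_eq_sub, ← Finset.sum_sub_distrib]
    refine (norm_sum_le _ _).trans (Finset.sum_le_sum fun i _ => ?_)
    rw [← sub_smul, norm_smul]
    gcongr
    have h := hC i (n * u n i t).toNNReal
    rw [Real.coe_toNNReal _ (mul_nonneg hn0.le (hu0 n hn i t ht))] at h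
    rw [Real.norm_eq_abs]
    have e1 : (y i (n * u n i t).toNNReal : ℝ) / n - u n i t =
        ((y i (n * u n i t).toNNReal : ℝ) - n * u n i t) / n := by field_simp
    rw [e1, abs_div, abs_of_pos hn0, div_le_iff₀ hn0]
    refine h.trans (le_of_eq ?_)
    field_simp
  have hxi : ∀ n : ℕ, 1 ≤ n → IntegrableOn (x n) (Icc 0 T) := by
    intro n hn
    have : IntegrableOn (fun t => x₀ + ∑ i, ((y i (n * u n i t).toNNReal : ℝ) / n) • v i)
        (Icc 0 T) := by
      refine Integrable.add (integrableOn_const (by simp)) (integrable_finsetSum _ fun i _ => ?_)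
      refine Integrable.smul_const (Integrable.div_const ?_ _) _
      refine MonotoneOn.integrableOn_isCompact isCompact_Icc fun s hs t ht hst => ?_
      have := humono n hn i hs ht hst
      exact Nat.cast_le.2 (hy i (Real.toNNReal_le_toNNReal (by gcongr)))
    exact this.congr_fun (fun t ht => (heq' n hn t ht).symm) measurableSet_Icc
  -- uniform bounds for the paths and for their clocks
  obtain ⟨C₁, hC₁0, hC₁⟩ := hlln' 1 one_pos
  have hxbound : ∀ n : ℕ, 1 ≤ n → ∀ t ∈ Icc 0 T, 1 + ‖x n t‖ ≤ 1 + ‖x₀‖ + ∑ i, (2 * u n i t + C₁) * ‖v i‖ := by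
    intro n hn t ht
    -- With `ε = 1` the deviation is at most `u n i t + C₁` per coordinate, whence the factor `2`.
    have h1 := herr 1 C₁ hC₁ n hn t ht
    have h2 : ‖x₀ + ∑ i, u n i t • v i‖ ≤ ‖x₀‖ + ∑ i, u n i t * ‖v i‖ := by
      refine (norm_add_le _ _).trans (add_le_add_right ((norm_sum_le _ _).trans
        (Finset.sum_le_sum fun i _ => ?_)) _)
      rw [norm_smul, Real.norm_of_nonneg (hu0 n hn i t ht)]
    have h3 : ∑ i, (1 * u n i t + C₁ / n) * ‖v i‖ ≤ ∑ i, (u n i t + C₁) * ‖v i‖ := by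
      gcongr with i
      · rw [one_mul]
      · exact div_le_self hC₁0 (by exact_mod_cast hn)
    have h4 : ∑ i, (2 * u n i t + C₁) * ‖v i‖ =
        ∑ i, u n i t * ‖v i‖ + ∑ i, (u n i t + C₁) * ‖v i‖ := by
      rw [← Finset.sum_add_distrib]
      exact Finset.sum_congr rfl fun i _ => by ring
    have h5 := norm_le_norm_sub_add (x n t) (x₀ + ∑ i, u n i t • v i)
    linarith
  have huint : ∀ n : ℕ, 1 ≤ n → ∀ i, ∀ t ∈ Icc 0 T,
      u n i t ≤ D * ∫ s in (0 : ℝ)..t, (1 + ‖x n s‖) := by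
    intro n hn i t ht
    rw [← intervalIntegral.integral_const_mul]
    refine intervalIntegral.integral_mono_on ht.1 (hI (hgi n hn i) t ht)
      (hI (((integrableOn_const (by simp)).add (hxi n hn).norm).const_mul D) t ht)
      fun s hs => hgD i s ⟨hs.1, hs.2.trans ht.2⟩ _
  set a := 1 + ‖x₀‖ + L * C₁
  set b := 2 * D * L
  have ha : 0 ≤ a := by positivity
  have hb : 0 ≤ b := by positivity
  have hxR : ∀ n : ℕ, 1 ≤ n → ∀ t ∈ Icc 0 T, 1 + ‖x n t‖ ≤ a * Real.exp (b * T) := by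
    intro n hn t ht
    -- Here `S` depends on `n`, but the resulting bound does not involve it.
    have h1 := le_mul_exp_of_le_add_integral (T := T) (φ := fun t => 1 + ‖x n t‖) ha hb
      (S := 1 + ‖x₀‖ + ∑ i, (2 * u n i T + C₁) * ‖v i‖)
      ((integrableOn_const (by simp)).add (hxi n hn).norm) (fun t ht => ?_) (fun t ht => ?_) t ht
    · refine h1.trans ?_
      gcongr
      exact ht.2
    · refine (hxbound n hn t ht).trans ?_
      gcongr with i
      exact humono n hn i ht (right_mem_Icc.2 hT) ht.2
    · refine (hxbound n hn t ht).trans ?_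
      have h2 : ∑ i, (2 * u n i t + C₁) * ‖v i‖ ≤
          ∑ i, (2 * (D * ∫ s in (0 : ℝ)..t, (1 + ‖x n s‖)) + C₁) * ‖v i‖ := by
        gcongr with i
        exact huint n hn i t ht
      rw [← Finset.mul_sum] at h2
      simp only [a, b]
      linarith
  set U := D * (T * (a * Real.exp (b * T)))
  have hU : 0 ≤ U := by positivity
  have huU : ∀ n : ℕ, 1 ≤ n → ∀ i, ∀ t ∈ Icc 0 T, u n i t ≤ U := by
    intro n hn i t ht
    refine (humono n hn i ht (right_mem_Icc.2 hT) ht.2).trans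
      ((huint n hn i T (right_mem_Icc.2 hT)).trans (mul_le_mul_of_nonneg_left ?_ hD))
    have := intervalIntegral.integral_mono_on hT
      (hI ((integrableOn_const (by simp)).add (hxi n hn).norm) T (right_mem_Icc.2 hT))
      (intervalIntegrable_const (c := a * Real.exp (b * T))) (fun s hs => hxR n hn s hs)
    rwa [intervalIntegral.integral_const, sub_zero, smul_eq_mul] at this
  have hzc := hz.continuousOn hT
  obtain ⟨Bz, hBz⟩ := isCompact_Icc.bddAbove_image hzc.norm
  have hzi := hzc.integrableOn_compact (μ := volume) isCompact_Icc
  have hdist : ∀ ε C : ℝ, 0 ≤ ε → 0 ≤ C → (∀ i, ∀ s : ℝ≥0, |(y i s : ℝ) - s| ≤ ε * s + C) →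
      ∀ n : ℕ, 1 ≤ n → ∀ t ∈ Icc 0 T,
      ‖x n t - z t‖ ≤ (ε * U + C / n) * L * Real.exp (M * T) := by
    intro ε C hε hC0 hC n hn t ht
    have hxz : IntegrableOn (fun s => ‖x n s - z s‖) (Icc 0 T) := ((hxi n hn).sub hzi).norm
    have h1 := le_mul_exp_of_le_add_integral (T := T) (φ := fun t => ‖x n t - z t‖)
      (a := (ε * U + C / n) * L) (by positivity) hM (S := a * Real.exp (b * T) + Bz)
      hxz (fun t ht => ?_) (fun t ht => ?_) t ht
    · refine h1.trans ?_
      gcongr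
      exact ht.2
    · have h2 : ‖z t‖ ≤ Bz := hBz (mem_image_of_mem (fun t => ‖z t‖) ht)
      have h3 := hxR n hn t ht
      have h4 := norm_sub_le (x n t) (z t)
      linarith
    · have h2 := herr ε C hC n hn t ht
      have h3 : ∑ i, (ε * u n i t + C / n) * ‖v i‖ ≤ (ε * U + C / n) * L := by
        rw [Finset.mul_sum]
        gcongr with i
        exact huU n hn i t ht
      have h4 := norm_sum_integral_smul_sub_le hg (hgi n hn) hz.integrable hxz ht
      have h5 : x n t - z t = (x n t - (x₀ + ∑ i, u n i t • v i)) +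
          ((∑ i, u n i t • v i) - ∑ i, (∫ s in (0 : ℝ)..t, g i s (z s)) • v i) := by
        rw [hz.equation t ht]
        abel
      rw [h5]
      exact (norm_add_le _ _).trans (add_le_add (h2.trans h3) h4)
  rw [Metric.tendstoUniformlyOn_iff]
  intro δ hδ
  -- Chosen so that `ε * U * Q ≤ δ / 2`; the remaining `C / n * Q` is below `δ / 2` for large `n`.
  set Q := L * Real.exp (M * T) + 1
  have hQ : 0 < Q := by positivity
  set ε := δ / (2 * (U + 1) * Q)
  have hε : 0 < ε := by positivity
  obtain ⟨C, hC0, hC⟩ := hlln' ε hε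
  have hlim : Tendsto (fun n : ℕ => C / n * Q) atTop (𝓝 (0 * Q)) :=
    (tendsto_const_div_atTop_nhds_zero_nat C).mul_const Q
  rw [zero_mul] at hlim
  filter_upwards [hlim.eventually_lt_const (half_pos hδ), eventually_ge_atTop 1] with n hn hn1 t ht
  rw [dist_comm, dist_eq_norm]
  have h1 := hdist ε C hε.le hC0 hC n hn1 t ht
  have h2 : (ε * U + C / n) * L * Real.exp (M * T) ≤ (ε * U + C / n) * Q := by
    rw [mul_assoc]
    have : 0 ≤ ε * U + C / n := by positivity
    exact mul_le_mul_of_nonneg_left (by simp [Q]) this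
  have h3 : ε * U * Q ≤ δ / 2 := by
    have h4 : ε * (U + 1) * Q = δ / 2 := by
      simp only [ε]
      field_simp
    rw [← h4]
    gcongr
    simp
  linarith
end

/-! ### From the time-change equation to counts and clocks -/

section

variable {d k : ℕ} {T : ℝ}

/-- The state reached from `x₀` after `c i` jumps by `v i`, for every `i`. -/
noncomputable def stateOfCounts (x₀ : EuclideanSpace ℝ (Fin d)) (v : Fin k → EuclideanSpace ℝ (Fin d))
    (c : Fin k → ℕ) : EuclideanSpace ℝ (Fin d) := x₀ + ∑ i, (c i : ℝ) • v i

/-- The jump rates on `[0, T]` as functions of the jump counts. -/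
noncomputable def countRate (T : ℝ) (x₀ : EuclideanSpace ℝ (Fin d))
    (v : Fin k → EuclideanSpace ℝ (Fin d)) (f : Fin k → ℝ → EuclideanSpace ℝ (Fin d) → ℝ)
    (j : Fin k) (c : Fin k → ℕ) : ℝ → ℝ :=
  (Icc 0 T).indicator fun s => max (f j s (stateOfCounts x₀ v c)) 0

variable {x₀ : EuclideanSpace ℝ (Fin d)} {v : Fin k → EuclideanSpace ℝ (Fin d)}
  {f : Fin k → ℝ → EuclideanSpace ℝ (Fin d) → ℝ} {C : ℝ}

theorem norm_stateOfCounts_le (c : Fin k → ℕ) :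
    ‖stateOfCounts x₀ v c‖ ≤ ‖x₀‖ + ∑ i, (c i : ℝ) * ‖v i‖ := by
  refine (norm_add_le _ _).trans (add_le_add_right ((norm_sum_le _ _).trans
    (Finset.sum_le_sum fun i _ => ?_)) _)
  rw [norm_smul, Real.norm_natCast]

/-- Truncation at `0` is needed because `f` is known to be nonnegative only along the solution,
whereas a rate family is nonnegative at every count vector. -/
theorem isRateFamily_countRate (hC : 0 ≤ C)
    (hf_cont : ∀ i, ContinuousOn (fun p : ℝ × EuclideanSpace ℝ (Fin d) => f i p.1 p.2)
      (Icc 0 T ×ˢ univ))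
    (hf_growth : ∀ i, ∀ t ∈ Icc 0 T, ∀ x, |f i t x| ≤ C * (1 + ‖x‖)) :
    IsRateFamily (countRate T x₀ v f) (C * (1 + ‖x₀‖ + ∑ i, ‖v i‖)) where
  measurable j c := by
    have h1 : ContinuousOn (fun s => f j s (stateOfCounts x₀ v c)) (Icc 0 T) :=
      (hf_cont j).comp (f := fun s : ℝ => (s, stateOfCounts x₀ v c)) (by fun_prop)
        fun s hs => ⟨hs, mem_univ _⟩
    have h2 := (h1.sup continuousOn_const (g := fun _ => (0 : ℝ))).measurable_piecewise
      (g := (0 : ℝ → ℝ)) continuousOn_const measurableSet_Icc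
    rwa [piecewise_eq_indicator] at h2
  nonneg j c s := indicator_nonneg (fun _ _ => le_max_right _ _) s
  le j c s := by
    have hL : 0 ≤ ∑ i, ‖v i‖ := Finset.sum_nonneg fun _ _ => norm_nonneg _
    refine indicator_le' (g := fun _ => _) (fun s hs => max_le ?_ (by positivity))
      (fun s _ => by positivity) s
    refine (le_abs_self _).trans ((hf_growth j s hs _).trans ?_)
    rw [mul_assoc]
    refine mul_le_mul_of_nonneg_left ?_ hC
    refine (add_le_add_right (norm_stateOfCounts_le c) 1).trans ?_
    have h1 : ∑ i, (c i : ℝ) * ‖v i‖ ≤ (∑ i, (c i : ℝ)) * ∑ i, ‖v i‖ := by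
      rw [Finset.mul_sum]
      gcongr with i
      exact Finset.single_le_sum (f := fun i => (c i : ℝ)) (fun _ _ => by positivity)
        (Finset.mem_univ i)
    have h2 : 0 ≤ ∑ i, (c i : ℝ) := by positivity
    have h3 := norm_nonneg x₀
    nlinarith [mul_nonneg h2 h3]

variable {Ω : Type*} [MeasurableSpace Ω] {P : Measure Ω} {Y : Fin k → ℝ≥0 → Ω → ℕ}
  {X : ℝ → Ω → EuclideanSpace ℝ (Fin d)}

/-- The internal clocks of a solution of the time-change equation. -/
noncomputable def pathClock (T : ℝ) (f : Fin k → ℝ → EuclideanSpace ℝ (Fin d) → ℝ)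
    (x : ℝ → EuclideanSpace ℝ (Fin d)) (t : ℝ) : Fin k → ℝ :=
  fun j => ∫ s in Ioc 0 t, (Icc 0 T).indicator (fun s => f j s (x s)) s

/-- The state is a function of the counts, so the equation closes on the clocks. Along almost every
path the rates are nonnegative, and the truncation in `countRate` is invisible. -/
theorem IsTimeChangeSolution.ae_isClockSolution
    (hY : IsIndepUnitPoissonFamily P Y) (hX : IsTimeChangeSolution P T x₀ Y v f X) :
    ∀ᵐ ω ∂P, IsClockSolution (countRate T x₀ v f) (samplePath Y ω)
        (pathClock T f fun s => X s ω) ∧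
      ∀ t ∈ Icc 0 T, X t ω = stateOfCounts x₀ v
          (counts (samplePath Y ω) (pathClock T f (fun s => X s ω) t)) ∧
        ∀ i, countRate T x₀ v f i (counts (samplePath Y ω) (pathClock T f (fun s => X s ω) t)) t =
          f i t (X t ω) := by
  filter_upwards [hX.rate_nonneg, hX.rate_integrable, hX.equation,
    ae_all_iff.2 fun i => (hY.poisson i).ae_isCountingPath] with ω hnn hint heq hpath
  have hpath' : ∀ j, IsCountingPath (samplePath Y ω j) := hpath
  have hclock : ∀ t ∈ Icc 0 T, ∀ j, pathClock T f (fun s => X s ω) t j =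
      ∫ s in (0 : ℝ)..t, f j s (X s ω) := by
    intro t ht j
    rw [intervalIntegral.integral_of_le ht.1]
    refine setIntegral_congr_fun measurableSet_Ioc fun s hs => ?_
    exact indicator_of_mem (s := Icc 0 T) ⟨hs.1.le, hs.2.trans ht.2⟩ (fun s => f j s (X s ω))
  have hstate : ∀ t ∈ Icc 0 T, X t ω = stateOfCounts x₀ v
      (counts (samplePath Y ω) (pathClock T f (fun s => X s ω) t)) := by
    intro t ht
    rw [heq t ht, stateOfCounts]
    congr 1
    refine Finset.sum_congr rfl fun i _ => ?_
    rw [counts_eq hpath', hclock t ht]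
    rfl
  have hrate : ∀ t i, countRate T x₀ v f i
      (counts (samplePath Y ω) (pathClock T f (fun s => X s ω) t)) t =
      (Icc 0 T).indicator (fun s => f i s (X s ω)) t := by
    intro t i
    by_cases ht : t ∈ Icc 0 T
    · rw [countRate, indicator_of_mem ht, indicator_of_mem ht, ← hstate t ht,
        max_eq_left (hnn i t ht)]
    · rw [countRate, indicator_of_notMem ht, indicator_of_notMem ht]
  refine ⟨⟨hpath', fun j => ?_, fun t => ?_⟩, fun t ht => ⟨hstate t ht, fun i => ?_⟩⟩
  · simp only [hrate]
    exact (integrable_indicator_iff measurableSet_Icc).2 (hint j)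
  · ext j
    simp only [runClock, hrate]
    rfl
  · rw [hrate, indicator_of_mem ht]

/-- First moments of a solution of the time-change equation. -/
theorem IsTimeChangeSolution.mean [IsProbabilityMeasure P]
    (hY : IsIndepUnitPoissonFamily P Y) (hX : IsTimeChangeSolution P T x₀ Y v f X)
    (hT : 0 ≤ T) (hC : 0 ≤ C)
    (hf_cont : ∀ i, ContinuousOn (fun p : ℝ × EuclideanSpace ℝ (Fin d) => f i p.1 p.2)
      (Icc 0 T ×ˢ univ))
    (hf_growth : ∀ i, ∀ t ∈ Icc 0 T, ∀ x, |f i t x| ≤ C * (1 + ‖x‖)) :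
    (∃ B, ∀ t ∈ Icc 0 T, Integrable (X t) P ∧ ∫ ω, ‖X t ω‖ ∂P ≤ B) ∧
    (∀ i, IntegrableOn (fun s => ∫ ω, f i s (X s ω) ∂P) (Icc 0 T)) ∧
    ∀ t ∈ Icc 0 T, ∫ ω, X t ω ∂P =
      x₀ + ∑ i, (∫ s in (0 : ℝ)..t, ∫ ω, f i s (X s ω) ∂P) • v i := by
  have hρ := isRateFamily_countRate (x₀ := x₀) (v := v) hC hf_cont hf_growth
  set K := C * (1 + ‖x₀‖ + ∑ i, ‖v i‖)
  have hK : 0 ≤ K := by positivity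
  have hae := hX.ae_isClockSolution hY
  set N : ℝ → Ω → Fin k → ℕ := fun t ω =>
    counts (samplePath Y ω) (pathClock T f (fun s => X s ω) t)
  have hN := fun t ht i => integral_counts_eq hY hρ hK (hae.mono fun _ h => h.1) (t := t) ht i
  have hXN : ∀ t ∈ Icc 0 T, X t =ᵐ[P] fun ω => stateOfCounts x₀ v (N t ω) := fun t ht =>
    hae.mono fun ω h => (h.2 t ht).1
  have hrate : ∀ t ∈ Icc 0 T, ∀ i, ∫ ω, countRate T x₀ v f i (N t ω) t ∂P =
      ∫ ω, f i t (X t ω) ∂P := fun t ht i =>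
    integral_congr_ae (hae.mono fun ω h => (h.2 t ht).2 i)
  have hNi : ∀ t ∈ Icc 0 T, ∀ i, Integrable (fun ω => (N t ω i : ℝ)) P := fun t ht i =>
    (hN t ht.1 i).1
  have hSi : ∀ t ∈ Icc 0 T, Integrable (fun ω => ∑ i, (N t ω i : ℝ) • v i) P := fun t ht =>
    integrable_finsetSum _ fun i _ => (hNi t ht i).smul_const (v i)
  have hXi : ∀ t ∈ Icc 0 T, Integrable (X t) P := fun t ht =>
    ((integrable_const x₀).add (hSi t ht)).congr (hXN t ht).symm
  refine ⟨⟨‖x₀‖ + ∑ i, Real.exp (k * K * T) * ‖v i‖, fun t ht => ⟨hXi t ht, ?_⟩⟩,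
    fun i => ?_, fun t ht => ?_⟩
  · have h1 : ∫ ω, ‖X t ω‖ ∂P ≤ ∫ ω, (‖x₀‖ + ∑ i, (N t ω i : ℝ) * ‖v i‖) ∂P := by
      refine integral_mono_ae (hXi t ht).norm ((integrable_const _).add
        (integrable_finsetSum _ fun i _ => (hNi t ht i).mul_const _)) ?_
      filter_upwards [hXN t ht] with ω h
      rw [h]
      exact norm_stateOfCounts_le _
    refine h1.trans ?_
    rw [integral_add (integrable_const _)
      (integrable_finsetSum _ fun i _ => (hNi t ht i).mul_const _),
      integral_finsetSum _ fun i _ => (hNi t ht i).mul_const _]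
    simp only [integral_mul_const, integral_const, probReal_univ, one_smul]
    gcongr with i
    refine (hN t ht.1 i).2.1.trans ?_
    gcongr
    exact ht.2
  · rw [integrableOn_Icc_iff_integrableOn_Ioc]
    exact (hN T hT i).2.2.1.congr_fun (fun s hs => hrate s ⟨hs.1.le, hs.2⟩ i) measurableSet_Ioc
  · rw [integral_congr_ae (hXN t ht)]
    simp only [stateOfCounts]
    rw [integral_add (integrable_const _) (hSi t ht),
      integral_finsetSum _ fun i _ => (hNi t ht i).smul_const (v i)]
    simp only [integral_smul_const, integral_const, probReal_univ, one_smul]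
    congr 1
    refine Finset.sum_congr rfl fun i _ => ?_
    rw [(hN t ht.1 i).2.2.2, intervalIntegral.integral_of_le ht.1]
    congr 1
    exact setIntegral_congr_fun measurableSet_Ioc fun s hs => hrate s ⟨hs.1.le, hs.2.trans ht.2⟩ i

end

/-! ### The main theorem -/

theorem theorem3 {Ω : Type*} [MeasurableSpace Ω] (P : Measure Ω) [IsProbabilityMeasure P]
    {d k : ℕ} (T : ℝ) (hT : 0 ≤ T)
    (x₀ : EuclideanSpace ℝ (Fin d)) (l : Fin k → Fin d → ℤ)
    (Y : Fin k → ℝ≥0 → Ω → ℕ) (hY : IsIndepUnitPoissonFamily P Y)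
    (f : Fin k → ℝ → EuclideanSpace ℝ (Fin d) → ℝ)
    (hf_cont : ∀ i, ContinuousOn (fun p : ℝ × EuclideanSpace ℝ (Fin d) => f i p.1 p.2)
      (Icc 0 T ×ˢ univ))
    (C : Fin k → ℝ) (hf_growth : ∀ i, ∀ t ∈ Icc 0 T, ∀ x, |f i t x| ≤ C i * (1 + ‖x‖))
    (M : ℝ) (hF_lip : ∀ t ∈ Icc 0 T, ∀ x y,
      ‖(∑ i, f i t x • intVec (l i)) - ∑ i, f i t y • intVec (l i)‖ ≤ M * ‖x - y‖)
    (X : ℝ → Ω → EuclideanSpace ℝ (Fin d))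
    (hX : IsTimeChangeSolution P T x₀ Y (fun i => intVec (l i)) f X)
    (Z : ℕ → ℝ → Ω → EuclideanSpace ℝ (Fin d))
    (hZ : ∀ n : ℕ, 1 ≤ n → IsTimeChangeSolution P T x₀ Y (fun i => (1 / (n : ℝ)) • intVec (l i))
      (fun i t x => (n : ℝ) * adjustedRate P X (f i) t x) (Z n)) :
    (∀ t ∈ Icc 0 T, Integrable (X t) P) ∧
    (∀ i, ∀ t ∈ Icc 0 T, ∀ m, Integrable (fun ω => f i t ((X t ω - ∫ ω', X t ω' ∂P) + m)) P) ∧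
    (∀ i, ∀ t ∈ Icc 0 T, Integrable (fun ω => f i t (X t ω)) P) ∧
    (∀ i, IntegrableOn (fun s => ∫ ω, f i s (X s ω) ∂P) (Icc 0 T)) ∧
    ∃ z : ℝ → EuclideanSpace ℝ (Fin d),
      IsFluidSolution T x₀ (fun i => intVec (l i)) (fun i => adjustedRate P X (f i)) z ∧
      (∀ w, IsFluidSolution T x₀ (fun i => intVec (l i)) (fun i => adjustedRate P X (f i)) w →
        ∀ t ∈ Icc 0 T, w t = z t) ∧
      (∀ᵐ ω ∂P, TendstoUniformlyOn (fun n t => Z n t ω) z atTop (Icc 0 T)) ∧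
      (∀ t ∈ Icc 0 T, z t = ∫ ω, X t ω ∂P) ∧
      (∀ t ∈ Icc 0 T, ∫ ω, X t ω ∂P =
        x₀ + ∑ i, (∫ s in (0 : ℝ)..t, ∫ ω, f i s (X s ω) ∂P) • intVec (l i)) := by
  have hC0 : ∀ i, 0 ≤ C i := fun i => by
    simpa using (abs_nonneg _).trans (hf_growth i 0 (left_mem_Icc.2 hT) 0)
  have hCs : 0 ≤ ∑ i, C i := Finset.sum_nonneg fun i _ => hC0 i
  have hgrowth : ∀ i, ∀ t ∈ Icc 0 T, ∀ x, |f i t x| ≤ (∑ i, C i) * (1 + ‖x‖) := by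
    intro i t ht x
    refine (hf_growth i t ht x).trans ?_
    gcongr
    exact Finset.single_le_sum (fun i _ => hC0 i) (Finset.mem_univ i)
  obtain ⟨⟨B, hB⟩, hfi, hmean⟩ := hX.mean hY hT hCs hf_cont hgrowth
  have hslice : ∀ i, ∀ t ∈ Icc 0 T, Continuous (f i t) := fun i t ht =>
    continuousOn_univ.1 ((hf_cont i).comp (f := fun x => (t, x)) (by fun_prop)
      fun x _ => ⟨ht, mem_univ _⟩)
  have hshift : ∀ t ∈ Icc 0 T, ∀ c, Integrable (fun ω => X t ω + c) P := fun t ht c =>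
    (hB t ht).1.add (integrable_const c)
  have hint : ∀ i, ∀ t ∈ Icc 0 T, ∀ c, Integrable (fun ω => f i t (X t ω + c)) P := by
    intro i t ht c
    refine Integrable.mono' (((integrable_const 1).add (hshift t ht c).norm).const_mul (∑ i, C i))
      ((hslice i t ht).comp_aestronglyMeasurable (hshift t ht c).aestronglyMeasurable)
      (.of_forall fun ω => hgrowth i t ht _)
  have hint' : ∀ i, ∀ t ∈ Icc 0 T, ∀ m,
      Integrable (fun ω => f i t ((X t ω - ∫ ω', X t ω' ∂P) + m)) P := by
    intro i t ht m
    refine (hint i t ht (m - ∫ ω', X t ω' ∂P)).congr (.of_forall fun ω => ?_)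
    dsimp only
    congr 1
    abel
  have hB0 : 0 ≤ B := (integral_nonneg fun ω => norm_nonneg _).trans (hB 0 (left_mem_Icc.2 hT)).2
  -- One `B` bounds `E‖X t‖`, the other the shift by the mean.
  have hgD : ∀ i, ∀ t ∈ Icc 0 T, ∀ x,
      adjustedRate P X (f i) t x ≤ (∑ i, C i) * (1 + 2 * B) * (1 + ‖x‖) := by
    intro i t ht x
    have hμ : ‖∫ ω, X t ω ∂P‖ ≤ B := (norm_integral_le_integral_norm _).trans (hB t ht).2
    have h1 : adjustedRate P X (f i) t x ≤
        ∫ ω, (∑ i, C i) * ((1 + B + ‖x‖) + ‖X t ω‖) ∂P := by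
      refine integral_mono (hint' i t ht x)
        (((integrable_const _).add (hB t ht).1.norm).const_mul _) fun ω => ?_
      refine (le_abs_self _).trans ((hgrowth i t ht _).trans ?_)
      refine mul_le_mul_of_nonneg_left ?_ hCs
      have h2 := norm_add_le (X t ω - ∫ ω', X t ω' ∂P) x
      have h3 := norm_sub_le (X t ω) (∫ ω', X t ω' ∂P)
      linarith
    rw [integral_const_mul, integral_add (integrable_const _) (hB t ht).1.norm] at h1
    simp only [integral_const, probReal_univ, one_smul] at h1
    refine h1.trans ?_
    rw [mul_assoc]
    refine mul_le_mul_of_nonneg_left ?_ hCs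
    have := (hB t ht).2
    nlinarith [mul_nonneg hB0 (norm_nonneg x)]
  -- Averaging over the law of the centred `X t` preserves the Lipschitz bound of the sum; `max M 0`
  -- is used because `M` has no assumed sign.
  have hgL : ∀ t ∈ Icc 0 T, ∀ x y, ‖(∑ i, adjustedRate P X (f i) t x • intVec (l i)) -
      ∑ i, adjustedRate P X (f i) t y • intVec (l i)‖ ≤ max M 0 * ‖x - y‖ := by
    intro t ht x y
    have e : ∀ x, ∑ i, adjustedRate P X (f i) t x • intVec (l i) =
        ∫ ω, ∑ i, f i t ((X t ω - ∫ ω', X t ω' ∂P) + x) • intVec (l i) ∂P := by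
      intro x
      rw [integral_finsetSum _ fun i _ => (hint' i t ht x).smul_const _]
      simp only [integral_smul_const]
      rfl
    rw [e, e, ← integral_sub
      (integrable_finsetSum _ fun i _ => (hint' i t ht x).smul_const _)
      (integrable_finsetSum _ fun i _ => (hint' i t ht y).smul_const _)]
    refine (norm_integral_le_of_norm_le_const (C := max M 0 * ‖x - y‖)
      (.of_forall fun ω => ?_)).trans (by simp)
    refine (hF_lip t ht _ _).trans ?_
    rw [add_sub_add_left_eq_sub]
    gcongr
    exact le_max_left _ _
  -- The mean of `X` is itself a solution, so existence needs no fixed-point argument.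
  have hz : IsFluidSolution T x₀ (fun i => intVec (l i)) (fun i => adjustedRate P X (f i))
      (fun t => ∫ ω, X t ω ∂P) := by
    refine ⟨fun i => ?_, fun t ht => ?_⟩
    · simpa only [adjustedRate_mean] using hfi i
    · simpa only [adjustedRate_mean] using hmean t ht
  refine ⟨fun t ht => (hB t ht).1, hint', fun i t ht => by simpa using hint i t ht 0, hfi,
    fun t => ∫ ω, X t ω ∂P, hz, fun w hw => hw.unique hT (le_max_right _ _) hgL hz, ?_,
    fun _ _ => rfl, hmean⟩
  have hZ' : ∀ᵐ ω ∂P, ∀ n : ℕ, 1 ≤ n →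
      (∀ i, ∀ s ∈ Icc 0 T, 0 ≤ (n : ℝ) * adjustedRate P X (f i) s (Z n s ω)) ∧
      (∀ i, IntegrableOn (fun s => (n : ℝ) * adjustedRate P X (f i) s (Z n s ω)) (Icc 0 T)) ∧
      ∀ t ∈ Icc 0 T, Z n t ω = x₀ + ∑ i,
        (Y i (∫ s in (0 : ℝ)..t, (n : ℝ) * adjustedRate P X (f i) s (Z n s ω)).toNNReal ω : ℝ) •
          ((1 / (n : ℝ)) • intVec (l i)) := by
    rw [ae_all_iff]
    intro n
    by_cases hn : 1 ≤ n
    · filter_upwards [(hZ n hn).rate_nonneg, (hZ n hn).rate_integrable, (hZ n hn).equation]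
        with ω h1 h2 h3 _ using ⟨h1, h2, h3⟩
    · exact .of_forall fun ω h => absurd h hn
  filter_upwards [hZ', ae_all_iff.2 fun i => (hY.poisson i).monotone,
    ae_all_iff.2 fun i => (hY.poisson i).ae_abs_sub_le] with ω h1 h2 h3
  exact tendstoUniformlyOn_fluid hT (le_max_right _ _) (by positivity) hgL hgD hz h2 h3
    (x := fun n t => Z n t ω) (fun n hn => (h1 n hn).1) (fun n hn => (h1 n hn).2.1)
    (fun n hn => (h1 n hn).2.2)
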